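/- Let $m,n,p$ be integers with $1\le m<n$, $p\le n$ and $m+p\ge n$, and let $\Omega\subset\mathbb C^n$ be open. Write $dd^c=\frac{i}{2\pi}\partial\overline\partial$, $\beta=dd^c|z|^2$, and $\mathbb B(a,r)=\{z:|z-a|<r\}$. A smooth real $(1,1)$-form $\theta$ on $\Omega$ is called $m$-positive if $\theta^j\wedge\beta^{n-j}\ge 0$ for $1\le j\le m$. A $(q,q)$-form $\alpha$ is called strongly $m$-positive if $\alpha=\sum_{k=1}^N a_k\,\alpha_{1,k}\wedge\dots\wedge\alpha_{q,k}$ with $N=\binom nq$, smooth functions $a_k\ge0$ and $m$-positive $(1,1)$-forms $\alpha_{j,k}$. A current $T$ of bidimension $(p,p)$ on $\Omega$ is called $m$-positive if $\langle T\wedge\beta^{n-m},\alpha\rangle\ge0$ for every strongly $m$-positive test form $\alpha$ of bidegree $(m+p-n,m+p-n)$ on $\Omega$. Let $T$ be an $m$-positive current of bidimension $(p,p)$ on $\Omega$ such that $dd^cT\wedge\beta^{p-1}$ is a positive (Radon) measure on $\Omega$. Then $T\wedge\beta^p$ is a positive Radon measure on $\Omega$, and for every $a\in\Omega$ the $m$-Lelong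 function $$\nu_T(a,r)=\frac{1}{r^{\frac{2n}{m}(m+p-n)}}\int_{\mathbb B(a,r)}T\wedge\beta^p ,\qquad 0<r<d(a,\partial\Omega)$$ (where $d(a,\partial\Omega)=+\infty$ if $\partial\Omega=\emptyset$), is finite, nonnegative and increasing (in the wide sense) in $r$. Hence the Lelong number $\nu_T(a)=\lim_{r\to0^+}\nu_T(a,r)$ exists as a finite number at every point $a\in\Omega$. -/

import Mathlib

open scoped Distributions ContDiff ComplexOrder
open MeasureTheory Filter Topology

noncomputable section

namespace Lelong

/-- The Hermitian space `ℂⁿ`, with its Euclidean norm. -/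
abbrev Cn (n : ℕ) : Type := EuclideanSpace ℂ (Fin n)

/-! ### Constant-coefficient forms -/

/-- The `ℂ`-vector space with basis `dz₁, …, dzₙ, dz̄₁, …, dz̄ₙ`. -/
abbrev Covectors (n : ℕ) : Type := (Fin n ⊕ₗ Fin n) → ℂ

/-- Complex-valued exterior forms on `ℂⁿ` with constant coefficients: the exterior algebra on
`dz₁, …, dzₙ, dz̄₁, …, dz̄ₙ`. The product of this ring is the wedge product. -/
def Forms (n : ℕ) : Type := ExteriorAlgebra ℂ (Covectors n)

instance (n : ℕ) : Ring (Forms n) :=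
  inferInstanceAs (Ring (ExteriorAlgebra ℂ (Covectors n)))

instance (n : ℕ) : Algebra ℂ (Forms n) :=
  inferInstanceAs (Algebra ℂ (ExteriorAlgebra ℂ (Covectors n)))

/-- The basis of `Forms n` made of the ordered wedge products of the `dzⱼ` and the `dz̄ⱼ`. -/
def formsBasis (n : ℕ) : Module.Basis (Finset (Fin n ⊕ₗ Fin n)) ℂ (Forms n) :=
  (Pi.basisFun ℂ (Fin n ⊕ₗ Fin n)).ExteriorAlgebra

/-- The finite-dimensional space of forms is normed by the maximum of the moduli of the
coefficients. -/
instance (n : ℕ) : NormedAddCommGroup (Forms n) :=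
  NormedAddCommGroup.induced (Forms n) (Finset (Fin n ⊕ₗ Fin n) → ℂ)
    (formsBasis n).equivFun (formsBasis n).equivFun.injective

instance (n : ℕ) : NormedSpace ℂ (Forms n) :=
  NormedSpace.induced ℂ (Forms n) (Finset (Fin n ⊕ₗ Fin n) → ℂ) (formsBasis n).equivFun

instance (n : ℕ) : FiniteDimensional ℂ (Forms n) := (formsBasis n).finiteDimensional_of_finite

/-- The form `dzⱼ`. -/
def dz {n : ℕ} (j : Fin n) : Forms n :=
  ExteriorAlgebra.ι ℂ (Pi.single (toLex (Sum.inl j)) (1 : ℂ) : Covectors n)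

/-- The form `dz̄ⱼ`. -/
def dzbar {n : ℕ} (j : Fin n) : Forms n :=
  ExteriorAlgebra.ι ℂ (Pi.single (toLex (Sum.inr j)) (1 : ℂ) : Covectors n)

/-- The space of constant forms of bidegree `(a, b)`, spanned by the products of `a` forms `dzⱼ`
and `b` forms `dz̄ⱼ`. -/
def bidegree (n a b : ℕ) : Submodule ℂ (Forms n) :=
  Submodule.span ℂ (Set.range (dz (n := n))) ^ a *
    Submodule.span ℂ (Set.range (dzbar (n := n))) ^ b

/-- The `(1,1)`-form `(i / 2π) ∑ Hⱼₖ dzⱼ ∧ dz̄ₖ`. It is real if and only if `H` is Hermitian. -/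
def form11 {n : ℕ} (H : Matrix (Fin n) (Fin n) ℂ) : Forms n :=
  (Complex.I / (2 * (Real.pi : ℂ))) • ∑ j, ∑ k, H j k • (dz j * dzbar k)

/-- The form `β = dd^c |z|² = (i / 2π) ∑ dzⱼ ∧ dz̄ⱼ`. -/
def beta (n : ℕ) : Forms n := form11 1

/-- Positivity of a form of top bidegree `(n, n)`: it is a nonnegative multiple of `βⁿ`, which is
`n! / πⁿ` times the Euclidean volume form. -/
def IsNonnegTop {n : ℕ} (u : Forms n) : Prop :=
  ∃ c : ℝ, 0 ≤ c ∧ u = (c : ℂ) • beta n ^ n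

/-! ### `m`-positive forms -/

/-- `θ` is a (smooth, real) `m`-positive `(1,1)`-form on `Ω`: `θ^j ∧ β^(n-j) ≥ 0` for
`1 ≤ j ≤ m`. -/
structure IsMPositiveForm {n : ℕ} (Ω : Set (Cn n)) (m : ℕ) (θ : Cn n → Forms n) : Prop where
  smooth : ContDiffOn ℝ ∞ θ Ω
  real : ∀ x ∈ Ω, ∃ H : Matrix (Fin n) (Fin n) ℂ, H.IsHermitian ∧ θ x = form11 H
  pos : ∀ x ∈ Ω, ∀ j : ℕ, 1 ≤ j → j ≤ m → IsNonnegTop (θ x ^ j * beta n ^ (n - j))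

/-- `α` is a strongly `m`-positive `(q,q)`-form on `Ω`: `α = ∑ₖ aₖ α₁ₖ ∧ … ∧ α_qₖ`, the sum having
`n.choose q` terms, with nonnegative smooth functions `aₖ` and `m`-positive `(1,1)`-forms
`αⱼₖ`. -/
def IsStronglyMPositiveForm {n : ℕ} (Ω : Set (Cn n)) (m q : ℕ) (α : Cn n → Forms n) : Prop :=
  ∃ (a : Fin (n.choose q) → Cn n → ℝ) (θ : Fin (n.choose q) → Fin q → Cn n → Forms n),
    (∀ k, ContDiffOn ℝ ∞ (a k) Ω ∧ ∀ x ∈ Ω, 0 ≤ a k x) ∧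
    (∀ k j, IsMPositiveForm Ω m (θ k j)) ∧
    ∀ x ∈ Ω, α x = ∑ k, (a k x : ℂ) • (List.ofFn fun j => θ k j x).prod

/-! ### Test forms -/

/-- Smooth compactly supported complex differential forms on the open set `Ω` (of all degrees),
with the LF topology. -/
abbrev TestForm {n : ℕ} (Ω : TopologicalSpace.Opens (Cn n)) : Type := 𝓓(Ω, Forms n)

variable {n : ℕ} {Ω : TopologicalSpace.Opens (Cn n)}

/-- The map `φ ↦ θ ∧ φ` on test forms, for a constant form `θ`. -/
def wedgeTest (θ : Forms n) : TestForm Ω →L[ℂ] TestForm Ω :=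
  TestFunction.postcompCLM (LinearMap.toContinuousLinearMap (LinearMap.mulLeft ℂ θ))

/-- A test function, seen as a test form of degree `0`. -/
def ofFunction : 𝓓(Ω, ℂ) →L[ℂ] TestForm Ω :=
  TestFunction.postcompCLM (LinearMap.toContinuousLinearMap (Algebra.linearMap ℂ (Forms n)))

/-- Multiplication of test forms by the complex number `c`. -/
def scale (c : ℂ) : TestForm Ω →L[ℂ] TestForm Ω :=
  TestFunction.postcompCLM (c • ContinuousLinearMap.id ℂ (Forms n))

/-- Derivative of the coefficients in the real direction `v`. -/
def dirDeriv (v : Cn n) : TestForm Ω →L[ℂ] TestForm Ω := TestFunction.lineDerivCLM ℂ v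

/-- `∂/∂zⱼ = (∂/∂xⱼ - i ∂/∂yⱼ) / 2`, acting on the coefficients. -/
def derivZ (j : Fin n) : TestForm Ω →L[ℂ] TestForm Ω :=
  scale (1 / 2) ∘L (dirDeriv (EuclideanSpace.single j 1) -
    scale Complex.I ∘L dirDeriv (EuclideanSpace.single j Complex.I))

/-- `∂/∂z̄ⱼ = (∂/∂xⱼ + i ∂/∂yⱼ) / 2`, acting on the coefficients. -/
def derivZbar (j : Fin n) : TestForm Ω →L[ℂ] TestForm Ω :=
  scale (1 / 2) ∘L (dirDeriv (EuclideanSpace.single j 1) +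
    scale Complex.I ∘L dirDeriv (EuclideanSpace.single j Complex.I))

/-- The operator `∂`. -/
def del : TestForm Ω →L[ℂ] TestForm Ω := ∑ j : Fin n, wedgeTest (dz j) ∘L derivZ j

/-- The operator `∂̄`. -/
def delbar : TestForm Ω →L[ℂ] TestForm Ω := ∑ j : Fin n, wedgeTest (dzbar j) ∘L derivZbar j

/-- The operator `dd^c = (i / 2π) ∂ ∂̄`, where `d = ∂ + ∂̄` and `d^c = (i / 4π) (∂̄ - ∂)`. -/
def ddcTest : TestForm Ω →L[ℂ] TestForm Ω :=
  scale (Complex.I / (2 * (Real.pi : ℂ))) ∘L del ∘L delbar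

/-! ### Currents -/

/-- Currents on `Ω` (of all bidimensions): continuous linear functionals on test forms. -/
abbrev Current {n : ℕ} (Ω : TopologicalSpace.Opens (Cn n)) : Type := TestForm Ω →L[ℂ] ℂ

namespace Current

/-- `T` has bidimension `(p,p)`: it is a functional of the component of bidegree `(p,p)` only. -/
def HasBidimension (T : Current Ω) (p : ℕ) : Prop :=
  ∀ a b : ℕ, (a, b) ≠ (p, p) → ∀ φ : TestForm Ω, (∀ x, φ x ∈ bidegree n a b) → T φ = 0

/-- The current `T ∧ β^k`. -/
def wedgeBeta (T : Current Ω) (k : ℕ) : Current Ω := T ∘L wedgeTest (beta n ^ k)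

/-- The current `dd^c T`, given by `⟨dd^c T, φ⟩ = ⟨T, dd^c φ⟩` (no sign appears because `T` has
even degree). -/
def ddc (T : Current Ω) : Current Ω := T ∘L ddcTest

/-- Let `m + p ≥ n`. A current `T` of bidimension `(p,p)` is `m`-positive if
`⟨T ∧ β^(n-m), α⟩ ≥ 0` (in particular, is real) for every strongly `m`-positive test form `α` of
bidegree `(m+p-n, m+p-n)`. -/
def IsMPositive (T : Current Ω) (m p : ℕ) : Prop :=
  ∀ α : TestForm Ω, IsStronglyMPositiveForm (Ω : Set (Cn n)) m (m + p - n) α →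
    0 ≤ T.wedgeBeta (n - m) α

/-- The current `S` of bidimension `(0,0)` is the positive Radon measure `μ` on `Ω`:
`⟨S, f⟩ = ∫ f dμ` for every test function `f`, and `μ` is finite on compact subsets of `Ω`.
Only the restriction of `μ` to `Ω` matters. -/
structure IsMeasure (S : Current Ω) (μ : Measure (Cn n)) : Prop where
  finite : ∀ K : Set (Cn n), IsCompact K → K ⊆ Ω → μ K < ⊤
  eq_integral : ∀ f : 𝓓(Ω, ℂ), S (ofFunction f) = ∫ x, f x ∂μ

end Current

/-- The `m`-Lelong function `r ↦ r^(-(2n/m)(m+p-n)) ∫_{B(a,r)} T ∧ β^p`, where the positive measure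
`σ` is `T ∧ β^p`. -/
def lelongFunction {n : ℕ} (m p : ℕ) (σ : Measure (Cn n)) (a : Cn n) (r : ℝ) : ℝ :=
  (1 / r ^ ((2 * (n : ℝ) / m) * ((m : ℝ) + p - n))) * σ.real (Metric.ball a r)

/-- The radii `r > 0` with `r < d(a, ∂Ω)`, where `d(a, ∂Ω) = ∞` if `∂Ω` is empty. -/
def radii (Ω : Set (Cn n)) (a : Cn n) : Set ℝ :=
  {r : ℝ | 0 < r ∧ ENNReal.ofReal r < Metric.infEDist a (frontier Ω)}

end Lelong

end

/-! Put `q = m + p - n`, `k = q n / m`, `t = |z - a|²`, let `γ = form11 (levi a z)` be `(i/2π) ∂t ∧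
∂̄t`, and let `σ = T ∧ β^p`. This `σ` is a measure because `f β^q` is strongly `m`-positive for
every test function `f ≥ 0`; M. Riesz extension and Riesz–Markov then apply (`exists_isMeasure`).

Monotonicity comes from two inequalities with the same radial weight `w ≥ 0`, supported in `s ≤ t ≤
R` with `s > 0`. Let `G(t) = ∫ₜᴿ w`. Testing `dd^c T ∧ β^(p-1) ≥ 0` on the nonnegative radial
function with first derivative `-G` and second derivative `w` gives `⟨T, w β^(p-1) ∧ γ⟩ ≥ ∫ G dσ`
(`ddcTest_radial`). Next, `t β - (n/m) γ` is `m`-positive (`isMPositiveForm_coneForm`). Since `γ² =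
0`, its `q`-th power has just two terms, and testing `T` on it gives `∫ t w dσ ≥ k ⟨T, w β^(p-1) ∧
γ⟩`. Eliminating the mixed term leaves `∫ (t w - k G) dσ ≥ 0`, an inequality about `σ` alone
(`integral_radial_nonneg`).

Let `w` tend to `t^(-k-1)` on `(s, R)`. The integrand tends to `R^(-k) 1_{t<R} - s^(-k) 1_{t≤s}`.
With `s = r₁²` and `R = r₂²` this compares the Lelong function at two radii
(`rpow_mul_measure_closedBall_le`). The Lelong number exists because the function is increasing and
bounded below by `0`. -/

noncomputable section

namespace Lelong

/-! ### Powers of sums of commuting square-zero elements. -/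

section Ring

variable {A : Type*} [Ring A]

/-- The binomial formula stops after the term linear in `y`. -/
lemma add_pow_of_mul_self_eq_zero {x y : A} (h : Commute x y) (hy : y * y = 0) (k : ℕ) :
    (x + y) ^ (k + 1) = x ^ (k + 1) + ((k + 1 : ℕ) : A) * (x ^ k * y) := by
  induction k with
  | zero => simp
  | succ k ih =>
    have h1 : x ^ k * y * x = x ^ (k + 1) * y := by
      rw [mul_assoc, ← h.eq, ← mul_assoc, pow_succ]
    have h2 : x ^ k * y * y = 0 := by rw [mul_assoc, hy, mul_zero]
    rw [pow_succ, ih, mul_add, add_mul, add_mul, mul_assoc _ (x ^ k * y) x, h1,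
      mul_assoc _ (x ^ k * y) y, h2, ← pow_succ]
    push_cast
    noncomm_ring

/-- Pigeonhole: every monomial of the expansion repeats some `w i`. -/
lemma sum_pow_eq_zero_of_card_lt {ι : Type*} (w : ι → A) (hc : ∀ i j, Commute (w i) (w j))
    (h0 : ∀ i, w i * w i = 0) (s : Finset ι) (k : ℕ) (hk : s.card < k) :
    (∑ i ∈ s, w i) ^ k = 0 := by
  classical
  induction s using Finset.induction_on generalizing k with
  | empty => simp at hk; simp [hk.ne']
  | insert i s hi ih =>
    rw [Finset.card_insert_of_notMem hi] at hk
    obtain ⟨k, rfl⟩ : ∃ l, k = l + 1 := ⟨k - 1, by omega⟩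
    rw [Finset.sum_insert hi, add_comm, add_pow_of_mul_self_eq_zero
      (Commute.sum_left _ _ _ fun j _ => hc j i) (h0 i), ih _ (by omega), ih _ (by omega)]
    simp

end Ring

/-! ### Algebra of `(1,1)`-forms and the trace formula. -/

section Algebra

variable {n : ℕ}

/-- Moving past two covectors changes the sign twice. Hence forms of type `(1,1)` commute. -/
lemma ι_mul_ι_comm (a b c : Covectors n) :
    Commute ((ExteriorAlgebra.ι ℂ a * ExteriorAlgebra.ι ℂ b : ExteriorAlgebra ℂ (Covectors n)))
      (ExteriorAlgebra.ι ℂ c) := by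
  have h1 := eq_neg_of_add_eq_zero_left (ExteriorAlgebra.ι_add_mul_swap (R := ℂ) b c)
  have h2 := eq_neg_of_add_eq_zero_left (ExteriorAlgebra.ι_add_mul_swap (R := ℂ) a c)
  rw [Commute, SemiconjBy, mul_assoc, h1, mul_neg, ← mul_assoc, h2, neg_mul, neg_neg, mul_assoc]

/-- The elementary form `dzⱼ ∧ dz̄ₖ`. -/
def dzz (j k : Fin n) : Forms n := dz j * dzbar k

lemma dzz_commute_dz (j k l : Fin n) : Commute (dzz j k) (dz l) := ι_mul_ι_comm _ _ _

lemma dzz_commute_dzbar (j k l : Fin n) : Commute (dzz j k) (dzbar l) := ι_mul_ι_comm _ _ _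

lemma dzz_commute (j k l o : Fin n) : Commute (dzz j k) (dzz l o) :=
  (dzz_commute_dz j k l).mul_right (dzz_commute_dzbar j k o)

lemma dz_mul_self (j : Fin n) : dz j * dz j = 0 := ExteriorAlgebra.ι_sq_zero _

lemma dzbar_mul_self (j : Fin n) : dzbar j * dzbar j = 0 := ExteriorAlgebra.ι_sq_zero _

lemma dzz_mul_of_left (j k l : Fin n) : dzz j k * dzz j l = 0 := by
  rw [dzz, dzz, ← mul_assoc, ← dzz, (dzz_commute_dz j k j).eq, dzz, ← mul_assoc, dz_mul_self,
    zero_mul, zero_mul]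

lemma dzz_mul_of_right (j k l : Fin n) : dzz j k * dzz l k = 0 := by
  rw [(dzz_commute j k l k).eq, dzz, mul_assoc, ← (dzz_commute_dzbar j k k).eq, dzz, mul_assoc,
    dzbar_mul_self, mul_zero, mul_zero]

lemma form11_eq (H : Matrix (Fin n) (Fin n) ℂ) :
    form11 H = (Complex.I / (2 * (Real.pi : ℂ))) • ∑ j, ∑ k, H j k • dzz j k := rfl

lemma form11_commute_dz (H : Matrix (Fin n) (Fin n) ℂ) (l : Fin n) :
    Commute (form11 H) (dz l) := by
  rw [form11_eq]
  exact (Commute.sum_left _ _ _ fun j _ => Commute.sum_left _ _ _ fun k _ =>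
    (dzz_commute_dz j k l).smul_left _).smul_left _

lemma form11_commute_dzbar (H : Matrix (Fin n) (Fin n) ℂ) (l : Fin n) :
    Commute (form11 H) (dzbar l) := by
  rw [form11_eq]
  exact (Commute.sum_left _ _ _ fun j _ => Commute.sum_left _ _ _ fun k _ =>
    (dzz_commute_dzbar j k l).smul_left _).smul_left _

lemma form11_commute_dzz (H : Matrix (Fin n) (Fin n) ℂ) (l o : Fin n) :
    Commute (form11 H) (dzz l o) :=
  (form11_commute_dz H l).mul_right (form11_commute_dzbar H o)

lemma form11_commute (H K : Matrix (Fin n) (Fin n) ℂ) : Commute (form11 H) (form11 K) := by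
  rw [form11_eq K]
  exact (Commute.sum_right _ _ _ fun j _ => Commute.sum_right _ _ _ fun k _ =>
    (form11_commute_dzz H j k).smul_right _).smul_right _

lemma form11_add (H K : Matrix (Fin n) (Fin n) ℂ) : form11 (H + K) = form11 H + form11 K := by
  simp only [form11_eq, Matrix.add_apply, add_smul, Finset.sum_add_distrib, smul_add]

lemma form11_smul (c : ℂ) (H : Matrix (Fin n) (Fin n) ℂ) : form11 (c • H) = c • form11 H := by
  simp only [form11_eq, Matrix.smul_apply, smul_eq_mul, mul_smul, ← Finset.smul_sum]
  rw [smul_comm]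

lemma form11_diagonal (d : Fin n → ℂ) : form11 (Matrix.diagonal d) =
    ∑ j, (Complex.I / (2 * (Real.pi : ℂ)) * d j) • dzz j j := by
  simp only [form11_eq, Finset.smul_sum, smul_smul]
  refine Finset.sum_congr rfl fun j _ => ?_
  rw [Finset.sum_eq_single j]
  · simp
  · intro k _ hk
    simp [Matrix.diagonal_apply_ne _ hk.symm]
  · simp

lemma beta_eq_sum : beta n = ∑ j, (Complex.I / (2 * (Real.pi : ℂ))) • dzz j j := by
  rw [beta, ← Matrix.diagonal_one, form11_diagonal]
  simp

/-- The square of a form of rank one vanishes. -/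
lemma form11_vecMulVec_mul_self (u v : Fin n → ℂ) :
    form11 (Matrix.vecMulVec u v) * form11 (Matrix.vecMulVec u v) = 0 := by
  have h : form11 (Matrix.vecMulVec u v) = (Complex.I / (2 * (Real.pi : ℂ))) •
      ((∑ j, u j • dz j) * ∑ k, v k • dzbar k) := by
    simp only [form11_eq, dzz, Finset.sum_mul_sum, Matrix.vecMulVec_apply, smul_mul_smul_comm]
  have hv : (∑ k, v k • dzbar k) * (∑ k, v k • dzbar k : Forms n) = 0 := by
    have : (∑ k, v k • dzbar k : Forms n) = (ExteriorAlgebra.ι ℂ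
        (∑ k, v k • (Pi.single (toLex (Sum.inr k)) (1 : ℂ) : Covectors n)) :
          ExteriorAlgebra ℂ (Covectors n)) := by
      rw [map_sum]
      simp only [map_smul]
      rfl
    rw [this]
    exact ExteriorAlgebra.ι_sq_zero _
  have hc : Commute (form11 (Matrix.vecMulVec u v)) (∑ j, u j • dz j) :=
    Commute.sum_right _ _ _ fun k _ => (form11_commute_dz _ k).smul_right _
  have h0 : form11 (Matrix.vecMulVec u v) * (∑ k, v k • dzbar k) = 0 := by
    rw [h, smul_mul_assoc, mul_assoc, hv, mul_zero, smul_zero]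
  conv_lhs => enter [2]; rw [h]
  rw [mul_smul_comm, ← mul_assoc, hc.eq, mul_assoc, h0, mul_zero, smul_zero]

/-- Used to discard from `β` the summands that annihilate `e` before taking powers. -/
lemma _root_.Commute.pow_mul_eq_pow_mul {A : Type*} [Monoid A] {x y e : A} (hxy : Commute x y)
    (h : x * e = y * e) (r : ℕ) : x ^ r * e = y ^ r * e := by
  induction r with
  | zero => simp
  | succ r ih => rw [pow_succ', mul_assoc, ih, ← mul_assoc, (hxy.pow_right r).eq, mul_assoc, h,
      ← mul_assoc, ← pow_succ]

/-- The summand `(i / 2π) dzⱼ ∧ dz̄ⱼ` of `β`. -/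
def betaTerm (j : Fin n) : Forms n := (Complex.I / (2 * (Real.pi : ℂ))) • dzz j j

lemma betaTerm_commute_dzz (i j k : Fin n) : Commute (betaTerm i) (dzz j k) :=
  (dzz_commute _ _ _ _).smul_left _

lemma betaTerm_commute (i j : Fin n) : Commute (betaTerm i) (betaTerm j) :=
  (betaTerm_commute_dzz _ _ _).smul_right _

lemma betaTerm_mul_dzz_left (j k : Fin n) : betaTerm j * dzz j k = 0 := by
  rw [betaTerm, smul_mul_assoc, dzz_mul_of_left, smul_zero]

lemma betaTerm_mul_dzz_right (j k : Fin n) : betaTerm k * dzz j k = 0 := by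
  rw [betaTerm, smul_mul_assoc, dzz_mul_of_right, smul_zero]

lemma betaTerm_mul_self (j : Fin n) : betaTerm j * betaTerm j = 0 := by
  conv_lhs => enter [2]; rw [betaTerm]
  rw [mul_smul_comm, betaTerm_mul_dzz_left, smul_zero]

lemma beta_eq_sum_betaTerm : beta n = ∑ j, betaTerm j := beta_eq_sum

/-- The `j`-th and `k`-th summands of `β` annihilate `dzⱼ ∧ dz̄ₖ`. The other `n - 2` have square
zero, so the `(n-1)`-st power of their sum vanishes. -/
lemma beta_pow_mul_dzz_of_ne {j k : Fin n} (h : j ≠ k) : beta n ^ (n - 1) * dzz j k = 0 := by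
  have hb : beta n = ∑ i ∈ {j, k}ᶜ, betaTerm i + (betaTerm j + betaTerm k) := by
    rw [beta_eq_sum_betaTerm, ← Finset.sum_pair h, Finset.sum_compl_add_sum]
  rw [Commute.pow_mul_eq_pow_mul (y := ∑ i ∈ {j, k}ᶜ, betaTerm i),
    sum_pow_eq_zero_of_card_lt _ betaTerm_commute betaTerm_mul_self, zero_mul]
  · have h2 : ({j, k} : Finset (Fin n)).card = 2 := Finset.card_pair h
    have h3 := Finset.card_le_univ ({j, k} : Finset (Fin n))
    rw [Finset.card_compl, h2, Fintype.card_fin]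
    rw [h2, Fintype.card_fin] at h3
    omega
  · rw [beta_eq_sum_betaTerm]
    exact Commute.sum_left _ _ _ fun i _ => Commute.sum_right _ _ _ fun l _ => betaTerm_commute i l
  · rw [hb, add_mul, add_mul, betaTerm_mul_dzz_left, betaTerm_mul_dzz_right, add_zero, add_zero]

/-- Split off the `j`-th summand of `β`. The rest `b` has `n - 1` summands, so `b ^ n = 0` and the
truncated binomial formula for `β ^ n` leaves only `n b^(n-1) betaTerm j`. -/
lemma beta_pow_mul_betaTerm (j : Fin n) :
    (n : Forms n) * (beta n ^ (n - 1) * betaTerm j) = beta n ^ n := by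
  obtain ⟨N, hN⟩ : ∃ N, n = N + 1 := ⟨n - 1, by have := j.pos; omega⟩
  set b : Forms n := ∑ i ∈ {j}ᶜ, betaTerm i with hbdef
  have hb : beta n = b + betaTerm j := by
    rw [beta_eq_sum_betaTerm, hbdef, ← Finset.sum_singleton betaTerm j, Finset.sum_compl_add_sum]
  have hc : Commute b (betaTerm j) := Commute.sum_left _ _ _ fun i _ => betaTerm_commute i j
  have h0 : b ^ n = 0 := by
    refine sum_pow_eq_zero_of_card_lt _ betaTerm_commute betaTerm_mul_self _ _ ?_
    rw [Finset.card_compl, Fintype.card_fin, Finset.card_singleton]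
    omega
  have h1 : beta n ^ (n - 1) * betaTerm j = b ^ (n - 1) * betaTerm j := by
    refine Commute.pow_mul_eq_pow_mul ?_ ?_ _
    · rw [hb]
      exact (Commute.refl b).add_left hc.symm
    · rw [hb, add_mul, betaTerm_mul_self, add_zero]
  have h2 := add_pow_of_mul_self_eq_zero hc (betaTerm_mul_self j) (n - 1)
  have h3 : n - 1 + 1 = n := by omega
  rw [h3, h0, zero_add, ← hb] at h2
  rw [h1, h2]

/-- Wedging a `(1,1)`-form with `β^(n-1)` gives its trace. -/
lemma beta_pow_mul_form11 (hn : n ≠ 0) (H : Matrix (Fin n) (Fin n) ℂ) :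
    beta n ^ (n - 1) * form11 H = (H.trace / n) • beta n ^ n := by
  have hn' : (n : ℂ) ≠ 0 := Nat.cast_ne_zero.2 hn
  have hj : ∀ j : Fin n, (Complex.I / (2 * (Real.pi : ℂ))) • (beta n ^ (n - 1) * dzz j j) =
      (n : ℂ)⁻¹ • beta n ^ n := by
    intro j
    rw [← beta_pow_mul_betaTerm j, ← nsmul_eq_mul, ← Nat.cast_smul_eq_nsmul ℂ, smul_smul,
      inv_mul_cancel₀ hn', one_smul, betaTerm, mul_smul_comm]
  have hsum : ∀ j : Fin n, ∑ k, H j k • (beta n ^ (n - 1) * dzz j k) =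
      H j j • (beta n ^ (n - 1) * dzz j j) := fun j =>
    Finset.sum_eq_single j (fun k _ hk => by rw [beta_pow_mul_dzz_of_ne hk.symm, smul_zero])
      (by simp)
  simp only [form11_eq, mul_smul_comm, Finset.mul_sum, hsum]
  simp only [Finset.smul_sum, smul_comm _ (H _ _), hj, smul_smul]
  rw [← Finset.sum_smul, Matrix.trace, div_eq_mul_inv, Finset.sum_mul]
  rfl

/-- Powers of `s β - c γ`, where `γ² = 0`. -/
lemma smul_beta_sub_pow (s c : ℂ) {γ : Forms n} (hγ : γ * γ = 0) (hc : Commute (beta n) γ)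
    (j : ℕ) : (s • beta n - c • γ) ^ (j + 1) =
      s ^ (j + 1) • beta n ^ (j + 1) - ((j + 1 : ℕ) * c * s ^ j) • (beta n ^ j * γ) := by
  rw [sub_eq_add_neg, ← neg_smul, add_pow_of_mul_self_eq_zero ((hc.smul_left s).smul_right (-c))
    (by rw [smul_mul_smul_comm, hγ, smul_zero]), smul_pow, smul_pow, smul_mul_smul_comm,
    ← nsmul_eq_mul, ← Nat.cast_smul_eq_nsmul ℂ, smul_smul, sub_eq_add_neg, ← neg_smul]
  congr 2
  ring

end Algebra

/-! ### The Levi matrix of `|z-a|²` and the extremal `m`-positive form. -/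

variable {n : ℕ}

/-- The coefficients of `∂|z-a|² ∧ ∂̄|z-a|²`. -/
def levi (a x : Cn n) : Matrix (Fin n) (Fin n) ℂ :=
  Matrix.vecMulVec (fun j => (starRingEnd ℂ) (x j - a j)) (fun k => x k - a k)

lemma levi_apply (a x : Cn n) (j k : Fin n) :
    levi a x j k = (starRingEnd ℂ) (x j - a j) * (x k - a k) := rfl

lemma levi_isHermitian (a x : Cn n) : (levi a x).IsHermitian := by
  ext j k
  simp [levi_apply, mul_comm]

lemma levi_trace (a x : Cn n) : (levi a x).trace = ((‖x - a‖ ^ 2 : ℝ) : ℂ) := by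
  rw [EuclideanSpace.norm_sq_eq, Matrix.trace, Complex.ofReal_sum]
  refine Finset.sum_congr rfl fun j _ => ?_
  rw [Matrix.diag_apply, levi_apply, ← Complex.normSq_eq_conj_mul_self, PiLp.sub_apply,
    Complex.normSq_eq_norm_sq]

lemma contDiff_coord (j : Fin n) : ContDiff ℝ ∞ (fun x : Cn n => x j) :=
  ((EuclideanSpace.proj j : Cn n →L[ℂ] ℂ).restrictScalars ℝ).contDiff

lemma contDiff_distSq (a : Cn n) : ContDiff ℝ ∞ (fun x : Cn n => ‖x - a‖ ^ 2) := by
  have h : (fun x : Cn n => ‖x - a‖ ^ 2) = fun x : Cn n => ∑ j, Complex.normSq (x j - a j) := by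
    ext x
    simp [EuclideanSpace.norm_sq_eq, Complex.normSq_eq_norm_sq]
  rw [h]
  refine ContDiff.sum fun j _ => ?_
  have hj : ContDiff ℝ ∞ (fun x : Cn n => x j - a j) := (contDiff_coord j).sub contDiff_const
  simp only [Complex.normSq_apply]
  have h1 : ContDiff ℝ ∞ (fun x : Cn n => (x j - a j).re) := Complex.reCLM.contDiff.comp hj
  have h2 : ContDiff ℝ ∞ (fun x : Cn n => (x j - a j).im) := Complex.imCLM.contDiff.comp hj
  exact (h1.mul h1).add (h2.mul h2)

lemma contDiff_levi (a : Cn n) (j k : Fin n) : ContDiff ℝ ∞ (fun x : Cn n => levi a x j k) := by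
  have h : ∀ j, ContDiff ℝ ∞ (fun x : Cn n => x j - a j) := fun j =>
    (contDiff_coord j).sub contDiff_const
  exact (Complex.conjCLE.contDiff.comp (h j)).mul (h k)

lemma contDiff_form11 {H : Cn n → Matrix (Fin n) (Fin n) ℂ}
    (hH : ∀ j k, ContDiff ℝ ∞ fun x => H x j k) : ContDiff ℝ ∞ fun x => form11 (H x) := by
  simp only [form11_eq]
  have h : ContDiff ℝ ∞ fun x => ∑ j, ∑ k, H x j k • (dzz j k : Forms n) :=
    ContDiff.sum fun j _ => ContDiff.sum fun k _ => (hH j k).smul (contDiff_const (c := dzz j k))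
  exact h.const_smul _

lemma _root_.ContDiff.ofReal_comp' {f : Cn n → ℝ} (hf : ContDiff ℝ ∞ f) :
    ContDiff ℝ ∞ fun x => (f x : ℂ) := Complex.ofRealCLM.contDiff.comp hf

/-- The form `|z-a|² β - c ∂|z-a|² ∧ ∂̄|z-a|²` (up to `i / 2π`). -/
def coneForm (c : ℝ) (a x : Cn n) : Forms n :=
  ((‖x - a‖ ^ 2 : ℝ) : ℂ) • beta n - (c : ℂ) • form11 (levi a x)

lemma coneForm_eq (c : ℝ) (a x : Cn n) : coneForm c a x =
    form11 (((‖x - a‖ ^ 2 : ℝ) : ℂ) • (1 : Matrix (Fin n) (Fin n) ℂ) + (-(c : ℂ)) • levi a x) := by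
  rw [form11_add, form11_smul, form11_smul, coneForm, beta, neg_smul, sub_eq_add_neg]

lemma coneForm_pow (c : ℝ) (a x : Cn n) (j : ℕ) : coneForm c a x ^ (j + 1) =
    ((‖x - a‖ ^ 2 : ℝ) : ℂ) ^ (j + 1) • beta n ^ (j + 1) -
      ((j + 1 : ℕ) * c * ((‖x - a‖ ^ 2 : ℝ) : ℂ) ^ j) • (beta n ^ j * form11 (levi a x)) :=
  smul_beta_sub_pow _ _ (form11_vecMulVec_mul_self _ _) (form11_commute _ _) j

lemma isMPositiveForm_beta (Ω : Set (Cn n)) {m : ℕ} (hm : m ≤ n) :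
    IsMPositiveForm Ω m fun _ => beta n where
  smooth := contDiffOn_const
  real _ _ := ⟨1, Matrix.isHermitian_one, rfl⟩
  pos _ _ j _ hj := ⟨1, zero_le_one, by
    rw [← pow_add, Nat.add_sub_cancel' (hj.trans hm), Complex.ofReal_one, one_smul]⟩

/-- The Levi form has trace `|x-a|²` and square zero, so the `j`-th power of `coneForm c a x` wedged
with `β^(n-j)` is `|x-a|^(2j) (1 - j c / n) β^n`. The constant `c = n / m` is the largest that keeps
this nonnegative up to `j = m`, and it is the source of the factor `n / m` in the Lelong exponent.
-/
lemma isMPositiveForm_coneForm (Ω : Set (Cn n)) {m : ℕ} (hm : 1 ≤ m) (hmn : m ≤ n) (a : Cn n) :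
    IsMPositiveForm Ω m (coneForm ((n : ℝ) / m) a) where
  smooth := by
    have h : ContDiff ℝ ∞ fun x : Cn n => coneForm ((n : ℝ) / m) a x :=
      ((contDiff_distSq a).ofReal_comp'.smul contDiff_const).sub
        ((contDiff_form11 (contDiff_levi a)).const_smul _)
    exact h.contDiffOn
  real x _ := by
    refine ⟨_, ?_, coneForm_eq _ a x⟩
    refine Matrix.IsHermitian.add ?_ ?_
    · rw [Matrix.IsHermitian, Matrix.conjTranspose_smul, Matrix.conjTranspose_one]
      simp
    · rw [Matrix.IsHermitian, Matrix.conjTranspose_smul, (levi_isHermitian a x).eq]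
      simp
  pos x _ j hj1 hjm := by
    obtain ⟨i, rfl⟩ : ∃ i, j = i + 1 := ⟨j - 1, by omega⟩
    have hn : n ≠ 0 := by omega
    have hn' : (n : ℂ) ≠ 0 := Nat.cast_ne_zero.2 hn
    have hm' : (m : ℂ) ≠ 0 := Nat.cast_ne_zero.2 (by omega)
    refine ⟨(‖x - a‖ ^ 2) ^ (i + 1) * (1 - (i + 1 : ℕ) / m), ?_, ?_⟩
    · have : ((i + 1 : ℕ) : ℝ) / m ≤ 1 := by
        rw [div_le_one (by exact_mod_cast hm)]
        exact_mod_cast hjm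
      exact mul_nonneg (by positivity) (by linarith)
    · have h1 : beta n ^ i * form11 (levi a x) * beta n ^ (n - (i + 1)) =
          (((‖x - a‖ ^ 2 : ℝ) : ℂ) / n) • beta n ^ n := by
        have hc : Commute (form11 (levi a x)) (beta n) := form11_commute _ 1
        rw [mul_assoc, (hc.pow_right _).eq, ← mul_assoc,
          ← levi_trace, ← beta_pow_mul_form11 hn]
        change beta n ^ i * beta n ^ _ * _ = _
        rw [← pow_add]
        congr 2
        omega
      rw [coneForm_pow, sub_mul, smul_mul_assoc, smul_mul_assoc, h1, ← pow_add,
        Nat.add_sub_cancel' (hjm.trans hmn), smul_smul, ← sub_smul]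
      congr 1
      push_cast
      field_simp
      ring

/-- The definition asks for exactly `n.choose q` summands: one carries the form and the others get
coefficient `0`. The bound `q ≤ n` makes room for that one. -/
lemma isStronglyMPositiveForm_smul_pow {Ω : Set (Cn n)} {m q : ℕ} (hq : q ≤ n)
    {θ α : Cn n → Forms n} (hθ : IsMPositiveForm Ω m θ) {b : Cn n → ℝ} (hb : ContDiff ℝ ∞ b)
    (hb0 : ∀ x, 0 ≤ b x) (hα : ∀ x, α x = (b x : ℂ) • θ x ^ q) :
    IsStronglyMPositiveForm Ω m q α := by
  let k₀ : Fin (n.choose q) := ⟨0, Nat.choose_pos hq⟩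
  refine ⟨fun k => if k = k₀ then b else 0, fun _ _ => θ, fun k => ?_, fun _ _ => hθ, fun x _ => ?_⟩
  · dsimp only
    split_ifs
    · exact ⟨hb.contDiffOn, fun x _ => hb0 x⟩
    · exact ⟨contDiffOn_const, fun x _ => le_rfl⟩
  · rw [Finset.sum_eq_single k₀]
    · simp [hα, List.ofFn_const]
    · intro k _ hk
      simp [hk]
    · simp

/-! ### Test forms -/

variable {Ω : TopologicalSpace.Opens (Cn n)}

/-- The test function given by a smooth function vanishing off a compact subset of `Ω`. -/
def mkTest {F : Type*} [NormedAddCommGroup F] [NormedSpace ℝ F] (f : Cn n → F)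
    (hf : ContDiff ℝ ∞ f) {K : Set (Cn n)} (hK : IsCompact K) (hKΩ : K ⊆ Ω)
    (h : ∀ x, x ∉ K → f x = 0) : 𝓓(Ω, F) where
  toFun := f
  contDiff' := hf
  hasCompactSupport' := HasCompactSupport.intro hK fun x hx => h x hx
  tsupport_subset' := (closure_minimal (Function.support_subset_iff'.2 h) hK.isClosed).trans hKΩ

lemma wedgeTest_apply (θ : Forms n) (φ : TestForm Ω) (x : Cn n) : wedgeTest θ φ x = θ * φ x := rfl

lemma ofFunction_apply (f : 𝓓(Ω, ℂ)) (x : Cn n) :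
    ofFunction f x = f x • (1 : Forms n) := Algebra.algebraMap_eq_smul_one (A := Forms n) (f x)

lemma dirDeriv_apply {φ : TestForm Ω} {v x : Cn n} {d : Forms n}
    (h : HasLineDerivAt ℝ φ d x v) : dirDeriv v φ x = d := by
  rw [dirDeriv, TestFunction.lineDerivCLM_apply, if_pos (by simp), h.lineDeriv]

lemma derivZ_apply {φ : TestForm Ω} {x : Cn n} {j : Fin n} {d : ℂ → Forms n}
    (h : ∀ v, HasLineDerivAt ℝ φ (d v) x (EuclideanSpace.single j v)) :
    derivZ j φ x = (1 / 2 : ℂ) • (d 1 - Complex.I • d Complex.I) := by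
  change (1 / 2 : ℂ) • (dirDeriv _ φ x - Complex.I • dirDeriv _ φ x) = _
  rw [dirDeriv_apply (h _), dirDeriv_apply (h _)]

lemma derivZbar_apply {φ : TestForm Ω} {x : Cn n} {j : Fin n} {d : ℂ → Forms n}
    (h : ∀ v, HasLineDerivAt ℝ φ (d v) x (EuclideanSpace.single j v)) :
    derivZbar j φ x = (1 / 2 : ℂ) • (d 1 + Complex.I • d Complex.I) := by
  change (1 / 2 : ℂ) • (dirDeriv _ φ x + Complex.I • dirDeriv _ φ x) = _
  rw [dirDeriv_apply (h _), dirDeriv_apply (h _)]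

lemma del_apply (φ : TestForm Ω) (x : Cn n) : del φ x = ∑ j, dz j * derivZ j φ x := by
  simp only [del, sum_apply]
  rfl

lemma delbar_apply (φ : TestForm Ω) (x : Cn n) : delbar φ x = ∑ j, dzbar j * derivZbar j φ x := by
  simp only [delbar, sum_apply]
  rfl

lemma hasLineDerivAt_distSq (a x : Cn n) (j : Fin n) (v : ℂ) :
    HasLineDerivAt ℝ (fun y : Cn n => ‖y - a‖ ^ 2)
      (2 * ((starRingEnd ℂ) (x j - a j) * v).re) x (EuclideanSpace.single j v) := by
  have h : (fun t : ℝ => ‖x + t • EuclideanSpace.single j v - a‖ ^ 2) = fun t : ℝ =>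
      ‖x - a‖ ^ 2 + t * (2 * ((starRingEnd ℂ) (x j - a j) * v).re) + t ^ 2 * ‖v‖ ^ 2 := by
    ext t
    have h1 : x + t • EuclideanSpace.single j v - a =
        (x - a) + EuclideanSpace.single j ((t : ℂ) * v) := by
      ext i
      by_cases hi : i = j
      · subst hi; simp; ring
      · simp [hi]
    rw [h1, norm_add_sq (𝕜 := ℂ), EuclideanSpace.inner_single_right]
    simp
    ring_nf
    rw [sq_abs]
  rw [HasLineDerivAt, h]
  have h2 := (((hasDerivAt_id (0 : ℝ)).mul_const
    (2 * ((starRingEnd ℂ) (x j - a j) * v).re)).const_add (‖x - a‖ ^ 2)).fun_add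
    ((hasDerivAt_pow 2 (0 : ℝ)).mul_const (‖v‖ ^ 2))
  simpa using h2

lemma hasLineDerivAt_comp_distSq {χ χ' : ℝ → ℝ} (hχ : ∀ t, HasDerivAt χ (χ' t) t) (a x : Cn n)
    (j : Fin n) (v : ℂ) :
    HasLineDerivAt ℝ (fun y : Cn n => (χ (‖y - a‖ ^ 2) : ℂ))
      ((χ' (‖x - a‖ ^ 2) * (2 * ((starRingEnd ℂ) (x j - a j) * v).re) : ℝ) : ℂ) x
      (EuclideanSpace.single j v) := by
  have h := hasLineDerivAt_distSq a x j v
  rw [HasLineDerivAt] at h ⊢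
  refine HasDerivAt.ofReal_comp ?_
  have h2 := hχ (‖x + (0 : ℝ) • EuclideanSpace.single j v - a‖ ^ 2)
  exact (h2.comp (0 : ℝ) h).congr_deriv (by simp)

lemma hasLineDerivAt_coord (a x : Cn n) (j k : Fin n) (v : ℂ) :
    HasLineDerivAt ℝ (fun y : Cn n => y k - a k) (if j = k then v else 0) x
      (EuclideanSpace.single j v) := by
  rw [HasLineDerivAt]
  have h : (fun t : ℝ => (x + t • EuclideanSpace.single j v : Cn n) k - a k) = fun t : ℝ =>
      (x k - a k) + (t : ℂ) * (if j = k then v else 0) := by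
    ext t
    by_cases hi : k = j
    · subst hi; simp; ring
    · simp [hi, Ne.symm hi]
  rw [h]
  simpa using ((Complex.ofRealCLM.hasDerivAt (x := (0 : ℝ))).mul_const
    (if j = k then v else 0)).const_add (x k - a k)

lemma delbar_radial {χ χ' : ℝ → ℝ} (hχ : ∀ t, HasDerivAt χ (χ' t) t) (a : Cn n) (B : Forms n)
    (φ : TestForm Ω) (hφ : ∀ x, φ x = (χ (‖x - a‖ ^ 2) : ℂ) • B) (x : Cn n) :
    delbar φ x = ∑ k, ((χ' (‖x - a‖ ^ 2) : ℂ) * (x k - a k)) • (dzbar k * B) := by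
  rw [delbar_apply]
  refine Finset.sum_congr rfl fun k _ => ?_
  have h : ∀ v, HasLineDerivAt ℝ φ (((χ' (‖x - a‖ ^ 2) *
      (2 * ((starRingEnd ℂ) (x k - a k) * v).re) : ℝ) : ℂ) • B) x
        (EuclideanSpace.single k v) := by
    intro v
    rw [show (φ : Cn n → Forms n) = fun y => (χ (‖y - a‖ ^ 2) : ℂ) • B from funext hφ]
    exact HasDerivAt.smul_const (hasLineDerivAt_comp_distSq hχ a x k v) B
  rw [derivZbar_apply h, smul_smul, ← add_smul, smul_smul, mul_smul_comm]
  congr 1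
  apply Complex.ext <;> simp <;> ring

/-- Chain rule: `dd^c χ(|z-a|²)` is `χ'` times `β` plus `χ''` times the Levi form; the factor `B`
has constant coefficients and is not differentiated. -/
lemma ddcTest_radial {χ χ' χ'' : ℝ → ℝ} (hχ : ∀ t, HasDerivAt χ (χ' t) t)
    (hχ' : ∀ t, HasDerivAt χ' (χ'' t) t) (a : Cn n) (B : Forms n)
    (φ : TestForm Ω) (hφ : ∀ x, φ x = (χ (‖x - a‖ ^ 2) : ℂ) • B) (x : Cn n) :
    ddcTest φ x = (χ' (‖x - a‖ ^ 2) : ℂ) • (beta n * B) +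
      (χ'' (‖x - a‖ ^ 2) : ℂ) • (form11 (levi a x) * B) := by
  have h0 : ddcTest φ x = (Complex.I / (2 * (Real.pi : ℂ))) • del (delbar φ) x := rfl
  have h : ∀ j v, HasLineDerivAt ℝ (delbar φ) (∑ k, (((χ'' (‖x - a‖ ^ 2) *
      (2 * ((starRingEnd ℂ) (x j - a j) * v).re) : ℝ) : ℂ) * (x k - a k) +
        (χ' (‖x - a‖ ^ 2) : ℂ) * (if j = k then v else 0)) • (dzbar k * B)) x
        (EuclideanSpace.single j v) := by
    intro j v
    rw [show (delbar φ : Cn n → Forms n) = fun y => ∑ k, ((χ' (‖y - a‖ ^ 2) : ℂ) *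
      (y k - a k)) • (dzbar k * B) from funext (delbar_radial hχ a B φ hφ)]
    refine HasDerivAt.fun_sum fun k _ => HasDerivAt.smul_const ?_ _
    exact (HasDerivAt.fun_mul (hasLineDerivAt_comp_distSq hχ' a x j v)
      (hasLineDerivAt_coord a x j k v)).congr_deriv (by simp)
  rw [h0, del_apply]
  have h1 : ∀ j, derivZ j (delbar φ) x = ∑ k, ((χ'' (‖x - a‖ ^ 2) • levi a x +
      χ' (‖x - a‖ ^ 2) • (1 : Matrix (Fin n) (Fin n) ℂ)) j k) • (dzbar k * B) := by
    intro j
    rw [derivZ_apply (h j), Finset.smul_sum, ← Finset.sum_sub_distrib, Finset.smul_sum]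
    refine Finset.sum_congr rfl fun k _ => ?_
    rw [smul_smul, ← sub_smul, smul_smul]
    congr 1
    rw [Matrix.add_apply, Matrix.smul_apply, Matrix.smul_apply, levi_apply, Matrix.one_apply]
    split_ifs <;> apply Complex.ext <;> simp <;> ring
  have h2 : (χ' (‖x - a‖ ^ 2) : ℂ) • (beta n * B) + (χ'' (‖x - a‖ ^ 2) : ℂ) •
      (form11 (levi a x) * B) = form11 (χ'' (‖x - a‖ ^ 2) • levi a x +
      χ' (‖x - a‖ ^ 2) • (1 : Matrix (Fin n) (Fin n) ℂ)) * B := by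
    rw [← smul_mul_assoc, ← smul_mul_assoc, ← add_mul, beta, ← form11_smul, ← form11_smul,
      ← form11_add, add_comm]
    rfl
  rw [h2]
  simp only [h1, form11, smul_mul_assoc, Finset.sum_mul, Finset.mul_sum, mul_smul_comm, mul_assoc]

/-! ### Positive functionals on test functions are Radon measures. -/

section Radon

open scoped CompactlySupported Manifold

variable {n : ℕ} {Ω : TopologicalSpace.Opens (Cn n)}

lemma exists_test_eq_one {K : Set (Cn n)} (hK : IsCompact K) (hKΩ : K ⊆ Ω) :
    ∃ ψ : 𝓓(Ω, ℝ), (∀ x, 0 ≤ ψ x) ∧ ∀ x ∈ K, ψ x = 1 := by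
  obtain ⟨L, hL, hKL, hLΩ⟩ := exists_compact_between hK Ω.isOpen hKΩ
  obtain ⟨f, hf0, hf1, hf⟩ := exists_contMDiffMap_zero_one_of_isClosed (n := (⊤ : ℕ∞)) 𝓘(ℝ, Cn n)
    (isOpen_interior (s := L)).isClosed_compl hK.isClosed
    (Set.disjoint_compl_left_iff_subset.2 hKL)
  refine ⟨mkTest f f.contMDiff.contDiff hL hLΩ fun x hx => hf0 fun h => hx (interior_subset h),
    fun x => (hf x).1, fun x hx => hf1 hx⟩

/-- Real test functions, seen as complex test functions. -/
def realTest : 𝓓(Ω, ℝ) →L[ℝ] 𝓓(Ω, ℂ) := TestFunction.postcompCLM Complex.ofRealCLM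

lemma realTest_apply (f : 𝓓(Ω, ℝ)) (x : Cn n) : realTest f x = (f x : ℂ) := rfl

lemma isCompact_preimage_val {K : Set (Cn n)} (hK : IsCompact K) (hKΩ : K ⊆ Ω) :
    IsCompact ((Subtype.val : Ω → Cn n) ⁻¹' K) :=
  (IsInducing.subtypeVal.isCompact_preimage_iff (by simpa using hKΩ)).2 hK

/-- Restriction of real test functions to `Ω`. -/
def testRestrict : 𝓓(Ω, ℝ) →ₗ[ℝ] C_c(Ω, ℝ) where
  toFun f := ⟨⟨fun x => f x, f.continuous.comp continuous_subtype_val⟩,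
    HasCompactSupport.intro (isCompact_preimage_val f.hasCompactSupport f.tsupport_subset)
      fun _ hx => image_eq_zero_of_notMem_tsupport (f := f) hx⟩
  map_add' _ _ := rfl
  map_smul' _ _ := rfl

lemma testRestrict_apply (f : 𝓓(Ω, ℝ)) (x : Ω) : testRestrict f x = f x := rfl

lemma testRestrict_injective : Function.Injective (testRestrict (Ω := Ω)) := by
  intro f g h
  ext x
  by_cases hx : x ∈ Ω
  · exact DFunLike.congr_fun h ⟨x, hx⟩
  · rw [image_eq_zero_of_notMem_tsupport fun h => hx (f.tsupport_subset h),
      image_eq_zero_of_notMem_tsupport fun h => hx (g.tsupport_subset h)]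

/-- Supplies the smooth majorants needed for Riesz extension, and for writing a real test function
as a difference of nonnegative ones. -/
lemma exists_test_dominating (g : C_c(Ω, ℝ)) :
    ∃ φ : 𝓓(Ω, ℝ), (∀ x, 0 ≤ φ x) ∧ ∀ x : Ω, |g x| ≤ φ x := by
  obtain ⟨ψ, hψ0, hψ1⟩ := exists_test_eq_one (Ω := Ω)
    (g.hasCompactSupport.isCompact.image continuous_subtype_val) (by rintro _ ⟨x, -, rfl⟩; exact x.2)
  obtain ⟨C, hC⟩ := g.hasCompactSupport.exists_bound_of_continuous g.continuous
  refine ⟨|C| • ψ, fun x => mul_nonneg (abs_nonneg C) (hψ0 x), fun x => ?_⟩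
  change |g x| ≤ |C| * ψ x
  by_cases hx : x ∈ tsupport g
  · rw [hψ1 _ ⟨x, hx, rfl⟩, mul_one]
    exact (hC x).trans (le_abs_self C)
  · rw [image_eq_zero_of_notMem_tsupport hx, abs_zero]
    exact mul_nonneg (abs_nonneg C) (hψ0 x)

/-- The cone of nonnegative functions. -/
def nonnegCone (X : Type*) [TopologicalSpace X] : PointedCone ℝ C_c(X, ℝ) where
  carrier := {f | ∀ x, 0 ≤ f x}
  add_mem' hf hg x := add_nonneg (hf x) (hg x)
  zero_mem' _ := le_rfl
  smul_mem' c _ hf x := mul_nonneg c.2 (hf x)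

/-- A positive linear functional on test functions is the integral against a Radon measure. -/
theorem exists_measure_of_nonneg (L : 𝓓(Ω, ℝ) →ₗ[ℝ] ℝ)
    (hL : ∀ f : 𝓓(Ω, ℝ), (∀ x, 0 ≤ f x) → 0 ≤ L f) :
    ∃ σ : Measure (Cn n), (∀ K : Set (Cn n), IsCompact K → K ⊆ Ω → σ K < ⊤) ∧
      ∀ f : 𝓓(Ω, ℝ), L f = ∫ x, f x ∂σ := by
  let e := LinearEquiv.ofInjective (testRestrict (Ω := Ω)) testRestrict_injective
  have hnonneg : ∀ f : 𝓓(Ω, ℝ), (∀ x : Ω, 0 ≤ f x) → ∀ x, 0 ≤ f x := by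
    intro f hf x
    by_cases hx : x ∈ Ω
    · exact hf ⟨x, hx⟩
    · rw [image_eq_zero_of_notMem_tsupport fun h => hx (f.tsupport_subset h)]
  -- `L` is transported to the image of the test functions in `C_c(Ω, ℝ)` and extended positively
  -- from there; no density or continuity argument is needed.
  obtain ⟨g, hg, hg0⟩ := riesz_extension (nonnegCone Ω)
    (⟨LinearMap.range (testRestrict (Ω := Ω)), L ∘ₗ e.symm.toLinearMap⟩ : C_c(Ω, ℝ) →ₗ.[ℝ] ℝ)
    (by
      intro y hy
      refine hL _ (hnonneg _ fun x => ?_)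
      have h : testRestrict (e.symm y) = (y : C_c(Ω, ℝ)) :=
        congrArg Subtype.val (e.apply_symm_apply y)
      have h2 := hy x
      rw [← h] at h2
      exact h2)
    (by
      intro y
      obtain ⟨φ, -, hφ⟩ := exists_test_dominating y
      refine ⟨⟨testRestrict φ, φ, rfl⟩, fun x => ?_⟩
      have := neg_abs_le (y x)
      change 0 ≤ φ x + y x
      linarith [hφ x])
  have hgL : ∀ f : 𝓓(Ω, ℝ), g (testRestrict f) = L f := by
    intro f
    rw [hg ⟨testRestrict f, f, rfl⟩]
    exact congrArg L (e.symm_apply_apply f)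
  let Λ : C_c(Ω, ℝ) →ₚ[ℝ] ℝ := PositiveLinearMap.mk₀ g fun x hx =>
    hg0 x (CompactlySupportedContinuousMap.le_def.1 hx)
  have hemb : MeasurableEmbedding (Subtype.val : Ω → Cn n) :=
    MeasurableEmbedding.subtype_coe Ω.isOpen.measurableSet
  have : LocallyCompactSpace Ω := Ω.isOpen.locallyCompactSpace
  refine ⟨(RealRMK.rieszMeasure Λ).map Subtype.val, fun K hK hKΩ => ?_, fun f => ?_⟩
  · rw [hemb.map_apply]
    exact (isCompact_preimage_val hK hKΩ).measure_lt_top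
  · rw [hemb.integral_map]
    have := RealRMK.integral_rieszMeasure Λ (testRestrict f)
    rw [← hgL f]
    exact this.symm

/-- A positive current of bidimension `(0, 0)` is a Radon measure. -/
theorem exists_isMeasure (S : Current Ω)
    (hS : ∀ f : 𝓓(Ω, ℝ), (∀ x, 0 ≤ f x) → 0 ≤ S (ofFunction (realTest f))) :
    ∃ σ : Measure (Cn n), S.IsMeasure σ := by
  let L : 𝓓(Ω, ℝ) →ₗ[ℝ] ℝ := Complex.reLm ∘ₗ
    ((S ∘L ofFunction).toLinearMap.restrictScalars ℝ) ∘ₗ realTest.toLinearMap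
  have hLre : ∀ f, L f = (S (ofFunction (realTest f))).re := fun _ => rfl
  obtain ⟨σ, hσ, hLσ⟩ := exists_measure_of_nonneg L fun f hf =>
    (Complex.nonneg_iff.1 (hS f hf)).1
  have hreal : ∀ f, S (ofFunction (realTest f)) = ((∫ x, f x ∂σ : ℝ) : ℂ) := by
    intro f
    rw [← hLσ, hLre]
    -- `S` is real on the nonnegative functions `φ` and `φ + f`, hence on `f`.
    obtain ⟨φ, hφ0, hφ⟩ := exists_test_dominating (testRestrict f)
    have h1 := (Complex.nonneg_iff.1 (hS φ hφ0)).2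
    have h2 := (Complex.nonneg_iff.1 (hS (φ + f) fun x => by
      change 0 ≤ φ x + f x
      by_cases hx : x ∈ Ω
      · have h3 := hφ ⟨x, hx⟩
        rw [testRestrict_apply] at h3
        linarith [neg_abs_le (f x)]
      · rw [image_eq_zero_of_notMem_tsupport fun h => hx (f.tsupport_subset h), add_zero]
        exact hφ0 x)).2
    rw [map_add, map_add, map_add, Complex.add_im, ← h1, zero_add] at h2
    exact Complex.ext (by simp) (by simpa using h2.symm)
  refine ⟨σ, hσ, fun f => ?_⟩
  let fr : 𝓓(Ω, ℝ) := TestFunction.postcompCLM Complex.reCLM f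
  let fi : 𝓓(Ω, ℝ) := TestFunction.postcompCLM Complex.imCLM f
  have hf : f = realTest fr + Complex.I • realTest fi := by
    ext x
    change f x = ((f x).re : ℂ) + Complex.I * ((f x).im : ℂ)
    rw [mul_comm, Complex.re_add_im]
  have hint : ∀ h : 𝓓(Ω, ℝ), Integrable (fun x => h x) σ := by
    intro h
    rw [← integrableOn_iff_integrable_of_support_subset (subset_tsupport h)]
    obtain ⟨C, hC⟩ := h.hasCompactSupport.exists_bound_of_continuous h.continuous
    exact .of_bound (hσ _ h.hasCompactSupport h.tsupport_subset)
      h.continuous.aestronglyMeasurable C (.of_forall hC)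
  conv_lhs => rw [hf]
  rw [map_add, map_add, map_smul, map_smul, hreal, hreal, ← integral_complex_ofReal,
    ← integral_complex_ofReal,
    smul_eq_mul, ← integral_const_mul, ← integral_add]
  · refine integral_congr_ae (.of_forall fun x => ?_)
    conv_rhs => rw [hf]
    rfl
  · exact (hint fr).ofReal
  · exact (hint fi).ofReal.const_mul _

end Radon

/-! ### Radial cutoffs -/

/-- The primitive `t ↦ ∫ₜᴿ w` of `-w`. -/
def tailIntegral (R : ℝ) (w : ℝ → ℝ) (t : ℝ) : ℝ := ∫ u in t..R, w u

lemma hasDerivAt_tailIntegral {w : ℝ → ℝ} (hw : Continuous w) (R t : ℝ) :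
    HasDerivAt (tailIntegral R w) (-w t) t :=
  intervalIntegral.integral_hasDerivAt_left (hw.intervalIntegrable _ _)
    hw.aestronglyMeasurable.stronglyMeasurableAtFilter hw.continuousAt

lemma contDiff_tailIntegral {w : ℝ → ℝ} (hw : ContDiff ℝ ∞ w) (R : ℝ) :
    ContDiff ℝ ∞ (tailIntegral R w) := by
  have h := hasDerivAt_tailIntegral hw.continuous R
  refine contDiff_infty_iff_deriv.2 ⟨fun t => (h t).differentiableAt, ?_⟩
  rw [show deriv (tailIntegral R w) = fun t => -w t from funext fun t => (h t).deriv]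
  exact hw.neg

lemma tailIntegral_eq_zero {w : ℝ → ℝ} {R : ℝ} (hR : ∀ t, R ≤ t → w t = 0) {t : ℝ} (ht : R ≤ t) :
    tailIntegral R w t = 0 := by
  rw [tailIntegral, intervalIntegral.integral_congr (g := fun _ => (0 : ℝ))]
  · simp
  · intro u hu
    rw [Set.uIcc_of_ge ht] at hu
    exact hR u hu.1

lemma tailIntegral_nonneg {w : ℝ → ℝ} {R : ℝ} (hR : ∀ t, R ≤ t → w t = 0) (hw : ∀ t, 0 ≤ w t)
    (t : ℝ) : 0 ≤ tailIntegral R w t := by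
  rcases le_total R t with h | h
  · rw [tailIntegral_eq_zero hR h]
  · exact intervalIntegral.integral_nonneg h fun u _ => hw u

/-- The power can fail to be smooth only at `0`, and `h` vanishes on a neighbourhood of `0`. -/
lemma contDiff_rpow_mul {h : ℝ → ℝ} (hh : ContDiff ℝ ∞ h) {s : ℝ} (hs : 0 < s)
    (h0 : ∀ t ≤ s, h t = 0) (e : ℝ) : ContDiff ℝ ∞ fun t => t ^ e * h t := by
  refine contDiff_iff_contDiffAt.2 fun t => ?_
  by_cases ht : t < s
  · refine contDiffAt_const (c := (0 : ℝ)) |>.congr_of_eventuallyEq ?_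
    filter_upwards [Iio_mem_nhds ht] with u hu
    rw [h0 u (le_of_lt hu), mul_zero]
  · exact (Real.contDiffAt_rpow_const_of_ne (by linarith)).mul hh.contDiffAt

/-- Smooth functions increasing to the characteristic function of `(s, R)`. -/
def cutoff (s R : ℝ) (j : ℕ) (t : ℝ) : ℝ :=
  Real.smoothTransition (j * (t - s)) * Real.smoothTransition (j * (R - t))

section Cutoff

variable {s R : ℝ}

lemma cutoff_nonneg (j : ℕ) (t : ℝ) : 0 ≤ cutoff s R j t :=
  mul_nonneg (Real.smoothTransition.nonneg _) (Real.smoothTransition.nonneg _)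

lemma cutoff_le_one (j : ℕ) (t : ℝ) : cutoff s R j t ≤ 1 :=
  mul_le_one₀ (Real.smoothTransition.le_one _) (Real.smoothTransition.nonneg _)
    (Real.smoothTransition.le_one _)

lemma cutoff_of_le (j : ℕ) {t : ℝ} (h : t ≤ s) : cutoff s R j t = 0 := by
  rw [cutoff, Real.smoothTransition.zero_of_nonpos (mul_nonpos_of_nonneg_of_nonpos (by positivity)
    (by linarith)), zero_mul]

lemma cutoff_of_ge (j : ℕ) {t : ℝ} (h : R ≤ t) : cutoff s R j t = 0 := by
  rw [cutoff, Real.smoothTransition.zero_of_nonpos (x := j * (R - t))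
    (mul_nonpos_of_nonneg_of_nonpos (by positivity) (by linarith)), mul_zero]

lemma contDiff_cutoff (j : ℕ) : ContDiff ℝ ∞ (cutoff s R j) :=
  (Real.smoothTransition.contDiff.comp (contDiff_const.mul (contDiff_id.sub contDiff_const))).mul
    (Real.smoothTransition.contDiff.comp (contDiff_const.mul (contDiff_const.sub contDiff_id)))

lemma eventually_cutoff_eq_one {t : ℝ} (hs : s < t) (hR : t < R) :
    ∀ᶠ j : ℕ in atTop, cutoff s R j t = 1 := by
  have h : ∀ c : ℝ, 0 < c → ∀ᶠ j : ℕ in atTop, 1 ≤ j * c := fun c hc =>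
    (tendsto_natCast_atTop_atTop.atTop_mul_const hc).eventually_ge_atTop 1
  filter_upwards [h _ (sub_pos.2 hs), h _ (sub_pos.2 hR)] with j h1 h2
  rw [cutoff, Real.smoothTransition.one_of_one_le h1, Real.smoothTransition.one_of_one_le h2,
    one_mul]

/-- A smooth approximation of `t ^ (-k-1)` on `(s, R)`. -/
def weight (k s R : ℝ) (j : ℕ) (t : ℝ) : ℝ := t ^ (-k - 1) * cutoff s R j t

variable {k : ℝ}

lemma contDiff_weight (hs : 0 < s) (j : ℕ) : ContDiff ℝ ∞ (weight k s R j) :=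
  contDiff_rpow_mul (contDiff_cutoff j) hs (fun _ h => cutoff_of_le j h) _

lemma weight_of_le (j : ℕ) {t : ℝ} (h : t ≤ s) : weight k s R j t = 0 := by
  rw [weight, cutoff_of_le j h, mul_zero]

lemma weight_of_ge (j : ℕ) {t : ℝ} (h : R ≤ t) : weight k s R j t = 0 := by
  rw [weight, cutoff_of_ge j h, mul_zero]

lemma weight_nonneg (hs : 0 < s) (j : ℕ) (t : ℝ) : 0 ≤ weight k s R j t := by
  rcases le_total t s with h | h
  · rw [weight_of_le j h]
  · exact mul_nonneg (Real.rpow_nonneg (hs.le.trans h) _) (cutoff_nonneg j t)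

lemma tailIntegral_weight_of_le (hs : 0 < s) (j : ℕ) {t : ℝ} (ht : t ≤ s) :
    tailIntegral R (weight k s R j) t = tailIntegral R (weight k s R j) s := by
  have hc : Continuous (weight k s R j) := (contDiff_weight hs j).continuous
  rw [tailIntegral, tailIntegral, ← intervalIntegral.integral_add_adjacent_intervals
    (hc.intervalIntegrable t s) (hc.intervalIntegrable s R),
    intervalIntegral.integral_congr (a := t) (g := fun _ => (0 : ℝ))]
  · simp
  · intro u hu
    rw [Set.uIcc_of_le ht] at hu
    exact weight_of_le j hu.2

lemma mul_integral_rpow (hk : 0 < k) (hs : 0 < s) (hsR : s ≤ R) :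
    k * ∫ u in s..R, u ^ (-k - 1) = s ^ (-k) - R ^ (-k) := by
  rw [integral_rpow (Or.inr ⟨by linarith, fun h => ?_⟩)]
  · rw [sub_add_cancel]
    field_simp
    ring
  · rw [Set.uIcc_of_le hsR] at h
    linarith [h.1]

lemma continuousOn_rpow_uIcc {c : ℝ} (hc : 0 < c) (hcR : c ≤ R) (e : ℝ) :
    ContinuousOn (fun u : ℝ => u ^ e) (Set.uIcc c R) := by
  rw [Set.uIcc_of_le hcR]
  exact fun u hu =>
    (Real.continuousAt_rpow_const u e (Or.inl (hc.trans_le hu.1).ne')).continuousWithinAt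

lemma weight_le (j : ℕ) {t : ℝ} (ht : 0 < t) : weight k s R j t ≤ t ^ (-k - 1) :=
  mul_le_of_le_one_right (Real.rpow_nonneg ht.le _) (cutoff_le_one j t)

/-- The bound is uniform in `j` and `t`, as dominated convergence requires. -/
lemma mul_tailIntegral_weight_le (hk : 0 < k) (hs : 0 < s) (hsR : s ≤ R) (j : ℕ) (t : ℝ) :
    k * tailIntegral R (weight k s R j) t ≤ s ^ (-k) := by
  have hR : 0 < R := hs.trans_le hsR
  have key : ∀ c, s ≤ c → k * tailIntegral R (weight k s R j) c ≤ s ^ (-k) := by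
    intro c hc
    rcases le_total R c with hRc | hcR
    · rw [tailIntegral_eq_zero (fun u hu => weight_of_ge j hu) hRc, mul_zero]
      exact Real.rpow_nonneg hs.le _
    · have hc0 : 0 < c := hs.trans_le hc
      calc k * tailIntegral R (weight k s R j) c ≤ k * ∫ u in c..R, u ^ (-k - 1) := by
            refine mul_le_mul_of_nonneg_left ?_ hk.le
            refine intervalIntegral.integral_mono_on hcR
              ((contDiff_weight hs j).continuous.intervalIntegrable _ _)
              (continuousOn_rpow_uIcc hc0 hcR _).intervalIntegrable fun u hu => ?_
            exact weight_le j (hc0.trans_le hu.1)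
        _ = c ^ (-k) - R ^ (-k) := mul_integral_rpow hk hc0 hcR
        _ ≤ c ^ (-k) := by linarith [Real.rpow_nonneg hR.le (-k)]
        _ ≤ s ^ (-k) := Real.rpow_le_rpow_of_nonpos hs hc (by linarith)
  rcases le_total t s with h | h
  · rw [tailIntegral_weight_of_le hs j h]
    exact key s le_rfl
  · exact key t h

lemma tendsto_mul_tailIntegral_weight (hk : 0 < k) {c : ℝ} (hs : 0 < s) (hsc : s ≤ c)
    (hcR : c ≤ R) : Tendsto (fun j => k * tailIntegral R (weight k s R j) c) atTop
      (𝓝 (c ^ (-k) - R ^ (-k))) := by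
  have hc : 0 < c := hs.trans_le hsc
  rw [← mul_integral_rpow hk hc hcR]
  refine Tendsto.const_mul k ?_
  refine intervalIntegral.tendsto_integral_filter_of_dominated_convergence
    (fun u => u ^ (-k - 1)) ?_ ?_ (continuousOn_rpow_uIcc hc hcR _).intervalIntegrable ?_
  · exact .of_forall fun j => (contDiff_weight hs j).continuous.aestronglyMeasurable
  · refine .of_forall fun j => .of_forall fun u hu => ?_
    rw [Set.uIoc_of_le hcR] at hu
    rw [Real.norm_of_nonneg (weight_nonneg hs j u)]
    exact weight_le j (hc.trans hu.1)
  -- Every cutoff vanishes at `u = R`, so pointwise convergence fails there; the point is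
  -- negligible.
  · have hne : ∀ᵐ u : ℝ, u ≠ R := by simp [ae_iff]
    filter_upwards [hne] with u hu1 hu
    rw [Set.uIoc_of_le hcR] at hu
    refine tendsto_const_nhds.congr' ?_
    filter_upwards [eventually_cutoff_eq_one (hsc.trans_lt hu.1) (lt_of_le_of_ne hu.2 hu1)]
      with j hj
    rw [weight, hj, mul_one]

lemma mul_weight_eq (hs : 0 < s) (j : ℕ) (t : ℝ) :
    t * weight k s R j t = t ^ (-k) * cutoff s R j t := by
  rcases le_total t s with h | h
  · rw [weight_of_le j h, cutoff_of_le j h, mul_zero, mul_zero]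
  · have ht : 0 < t := hs.trans_le h
    rw [weight, ← mul_assoc, Real.rpow_sub_one ht.ne', mul_div_cancel₀ _ ht.ne']

/-- Both terms lie in `[0, s^(-k)]`, so their difference is bounded by the same constant. -/
lemma abs_radial_le (hk : 0 < k) (hs : 0 < s) (hsR : s ≤ R) (j : ℕ) (t : ℝ) :
    |t * weight k s R j t - k * tailIntegral R (weight k s R j) t| ≤ s ^ (-k) := by
  have h1 := mul_tailIntegral_weight_le hk hs hsR j t
  have h2 : 0 ≤ k * tailIntegral R (weight k s R j) t :=
    mul_nonneg hk.le (tailIntegral_nonneg (fun u hu => weight_of_ge j hu) (weight_nonneg hs j) t)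
  have h3 : 0 ≤ t * weight k s R j t ∧ t * weight k s R j t ≤ s ^ (-k) := by
    rcases le_total t s with h | h
    · rw [weight_of_le j h, mul_zero]
      exact ⟨le_rfl, Real.rpow_nonneg hs.le _⟩
    · refine ⟨mul_nonneg (hs.le.trans h) (weight_nonneg hs j t), ?_⟩
      rw [mul_weight_eq hs]
      exact (mul_le_of_le_one_right (Real.rpow_nonneg (hs.le.trans h) _) (cutoff_le_one j t)).trans
        (Real.rpow_le_rpow_of_nonpos hs h (by linarith))
  rw [abs_le]
  constructor <;> linarith [h3.1, h3.2]

/-- For `s < t < R` the limit is `t^(-k) - (t^(-k) - R^(-k))`. The exponent `-k-1` of the weight is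
chosen so that the dependence on `t` cancels. For `t ≤ s` only the full tail integral remains. -/
lemma tendsto_radial (hk : 0 < k) (hs : 0 < s) (hsR : s < R) (t : ℝ) :
    Tendsto (fun j => t * weight k s R j t - k * tailIntegral R (weight k s R j) t) atTop
      (𝓝 ((Set.Iio R).indicator (fun _ => R ^ (-k)) t -
        (Set.Iic s).indicator (fun _ => s ^ (-k)) t)) := by
  rcases le_or_gt t s with h | h
  · rw [Set.indicator_of_mem (show t ∈ Set.Iic s from h),
      Set.indicator_of_mem (show t ∈ Set.Iio R from h.trans_lt hsR)]
    simp only [weight_of_le _ h, tailIntegral_weight_of_le hs _ h, mul_zero, zero_sub]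
    simpa using (tendsto_mul_tailIntegral_weight hk hs le_rfl hsR.le).neg
  · rw [Set.indicator_of_notMem (show t ∉ Set.Iic s from not_le.2 h), sub_zero]
    rcases lt_or_ge t R with h' | h'
    · rw [Set.indicator_of_mem (show t ∈ Set.Iio R from h')]
      have h1 := tendsto_mul_tailIntegral_weight hk hs h.le h'.le
      have h2 : Tendsto (fun j => t * weight k s R j t) atTop (𝓝 (t ^ (-k))) := by
        refine tendsto_const_nhds.congr' ?_
        filter_upwards [eventually_cutoff_eq_one h h'] with j hj
        rw [mul_weight_eq hs, hj, mul_one]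
      simpa using h2.sub h1
    · rw [Set.indicator_of_notMem (show t ∉ Set.Iio R from not_lt.2 h')]
      simp only [weight_of_ge _ h', mul_zero,
        tailIntegral_eq_zero (fun u hu => weight_of_ge _ hu) h', sub_zero]
      exact tendsto_const_nhds

end Cutoff

/-! ### The radial inequality and monotonicity of the Lelong function. -/

section Inequality

variable {n : ℕ} {Ω : TopologicalSpace.Opens (Cn n)} {T : Current Ω} {m p : ℕ}

lemma exists_isMeasure_wedgeBeta (hmn : m ≤ n) (hp : p ≤ n) (hmp : n ≤ m + p)
    (hpos : T.IsMPositive m p) : ∃ σ : Measure (Cn n), (T.wedgeBeta p).IsMeasure σ := by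
  refine exists_isMeasure _ fun f hf => ?_
  have h := hpos (wedgeTest (beta n ^ (m + p - n)) (ofFunction (realTest f)))
    (isStronglyMPositiveForm_smul_pow (by omega) (isMPositiveForm_beta _ hmn) f.contDiff hf
      fun x => by rw [wedgeTest_apply, ofFunction_apply, mul_smul_comm, mul_one, realTest_apply])
  have e : wedgeTest (beta n ^ (n - m)) (wedgeTest (beta n ^ (m + p - n))
      (ofFunction (realTest f))) = wedgeTest (beta n ^ p) (ofFunction (realTest f)) := by
    ext x : 1
    rw [wedgeTest_apply, wedgeTest_apply, wedgeTest_apply, ← mul_assoc, ← pow_add]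
    congr 2
    omega
  change 0 ≤ T (wedgeTest _ _) at h ⊢
  rwa [e] at h

/-- Testing `dd^c T ∧ β^(p-1) ≥ 0` against a radial function and the `m`-positivity of `T` against
a power of a form with one negative eigenvalue gives an inequality for `T ∧ β^p` alone. -/
theorem integral_radial_nonneg (hm : 1 ≤ m) (hmn : m < n) (hp : p ≤ n) (hmp : n < m + p)
    (hpos : T.IsMPositive m p) {μ σ : Measure (Cn n)}
    (hμ : (T.ddc.wedgeBeta (p - 1)).IsMeasure μ) (hσ : (T.wedgeBeta p).IsMeasure σ)
    {a : Cn n} {r s R : ℝ} (hr : 0 ≤ r) (hrR : r ^ 2 = R)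
    (hball : Metric.closedBall a r ⊆ Ω) (hs : 0 < s) {w : ℝ → ℝ}
    (hw : ContDiff ℝ ∞ w) (hw0 : ∀ t, 0 ≤ w t) (hws : ∀ t ≤ s, w t = 0)
    (hwR : ∀ t, R ≤ t → w t = 0) :
    0 ≤ ∫ x, (‖x - a‖ ^ 2 * w (‖x - a‖ ^ 2) -
      ((m + p - n : ℕ) * (n / m) : ℝ) * tailIntegral R w (‖x - a‖ ^ 2)) ∂σ := by
  set q := m + p - n with hq
  set k : ℝ := q * (n / m) with hk
  have hk0 : 0 ≤ k := by positivity
  have hK : IsCompact (Metric.closedBall a r) := isCompact_closedBall a r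
  have hout : ∀ x, x ∉ Metric.closedBall a r → R ≤ ‖x - a‖ ^ 2 := by
    intro x hx
    rw [mem_closedBall_iff_norm, not_le] at hx
    rw [← hrR]
    exact pow_le_pow_left₀ hr hx.le 2
  have hd := contDiff_distSq a
  have hG := contDiff_tailIntegral hw R
  have hG0 : ∀ t, R ≤ t → tailIntegral R w t = 0 := fun t => tailIntegral_eq_zero hwR
  -- Each tail integral is minus a primitive, so two of them give a nonnegative function whose
  -- second derivative is `w`.
  let f : 𝓓(Ω, ℂ) := mkTest (fun x => ((tailIntegral R (tailIntegral R w) (‖x - a‖ ^ 2) : ℝ) : ℂ))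
    ((contDiff_tailIntegral hG R).comp hd).ofReal_comp' hK hball
    fun x hx => by rw [tailIntegral_eq_zero hG0 (hout x hx), Complex.ofReal_zero]
  let f₁ : 𝓓(Ω, ℂ) := mkTest (fun x => ((tailIntegral R w (‖x - a‖ ^ 2) : ℝ) : ℂ))
    (hG.comp hd).ofReal_comp' hK hball
    fun x hx => by rw [hG0 _ (hout x hx), Complex.ofReal_zero]
  let f₂ : 𝓓(Ω, ℂ) := mkTest (fun x => ((‖x - a‖ ^ 2 * w (‖x - a‖ ^ 2) : ℝ) : ℂ))
    (hd.mul (hw.comp hd)).ofReal_comp' hK hball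
    fun x hx => by rw [hwR _ (hout x hx), mul_zero, Complex.ofReal_zero]
  let ψ : ℕ → TestForm Ω := fun l => mkTest
    (fun x => ((w (‖x - a‖ ^ 2) : ℝ) : ℂ) • (beta n ^ l * form11 (levi a x)))
    ((hw.comp hd).ofReal_comp'.smul
      ((LinearMap.toContinuousLinearMap
        (LinearMap.mulLeft ℝ (beta n ^ l))).contDiff.comp (contDiff_form11 (contDiff_levi a))))
    hK hball fun x hx => by rw [hwR _ (hout x hx), Complex.ofReal_zero, zero_smul]
  have hc : ∀ x, Commute (beta n) (form11 (levi a x)) := fun x => form11_commute _ _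
  have h1 : 0 ≤ T (ψ (p - 1)) - T (wedgeTest (beta n ^ p) (ofFunction f₁)) := by
    have e : ddcTest (wedgeTest (beta n ^ (p - 1)) (ofFunction f)) =
        ψ (p - 1) - wedgeTest (beta n ^ p) (ofFunction f₁) := by
      ext x : 1
      rw [ddcTest_radial (hasDerivAt_tailIntegral hG.continuous R)
        (fun t => (hasDerivAt_tailIntegral hw.continuous R t).fun_neg) a (beta n ^ (p - 1)) _
        (fun y => by rw [wedgeTest_apply, ofFunction_apply, mul_smul_comm, mul_one]; rfl) x]
      change _ = ψ (p - 1) x - wedgeTest (beta n ^ p) (ofFunction f₁) x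
      rw [wedgeTest_apply, ofFunction_apply, mul_smul_comm, mul_one, ← pow_succ',
        Nat.sub_add_cancel (by omega), ← ((hc x).pow_left _).eq, neg_neg, Complex.ofReal_neg,
        neg_smul, neg_add_eq_sub]
      rfl
    have h := hμ.eq_integral f
    change T (ddcTest (wedgeTest (beta n ^ (p - 1)) (ofFunction f))) = _ at h
    rw [e, map_sub] at h
    rw [h]
    change 0 ≤ ∫ x, ((tailIntegral R (tailIntegral R w) (‖x - a‖ ^ 2) : ℝ) : ℂ) ∂μ
    rw [integral_complex_ofReal]
    exact Complex.zero_le_real.2 (integral_nonneg fun x =>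
      tailIntegral_nonneg hG0 (tailIntegral_nonneg hwR hw0) _)
  have h2 : 0 ≤ T (wedgeTest (beta n ^ p) (ofFunction f₂)) - (k : ℂ) * T (ψ (p - 1)) := by
    obtain ⟨i, hi⟩ : ∃ i, q = i + 1 := ⟨q - 1, by omega⟩
    -- The `q`-th power of the cone form carries a common factor `t^i`, with `i = q - 1`. Dividing
    -- by it stays smooth because `w` vanishes for `t ≤ s`.
    have hcoef : ∀ t : ℝ, t ^ i * (t ^ (-(i : ℝ)) * w t) = w t := by
      intro t
      rcases le_or_gt t s with h | h
      · rw [hws t h, mul_zero, mul_zero]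
      · have ht := hs.trans h
        rw [Real.rpow_neg ht.le, Real.rpow_natCast, mul_inv_cancel_left₀ (pow_pos ht i).ne']
    have hval : ∀ x, (((‖x - a‖ ^ 2) ^ (-(i : ℝ)) * w (‖x - a‖ ^ 2) : ℝ) : ℂ) •
        coneForm ((n : ℝ) / m) a x ^ q =
          ((‖x - a‖ ^ 2 * w (‖x - a‖ ^ 2) : ℝ) : ℂ) • beta n ^ q -
          (k : ℂ) • ((w (‖x - a‖ ^ 2) : ℝ) : ℂ) • (beta n ^ i * form11 (levi a x)) := by
      intro x
      have h := hcoef (‖x - a‖ ^ 2)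
      rw [hi, coneForm_pow, smul_sub, smul_smul, smul_smul, smul_smul, hk, hi]
      generalize ‖x - a‖ ^ 2 = t at h ⊢
      generalize t ^ (-(i : ℝ)) * w t = u at h ⊢
      rw [← h]
      congr 2 <;> push_cast <;> ring
    have h := hpos (wedgeTest (beta n ^ q) (ofFunction f₂) - (k : ℂ) • ψ i)
      (isStronglyMPositiveForm_smul_pow (by omega) (isMPositiveForm_coneForm _ hm hmn.le a)
        (b := fun x => (‖x - a‖ ^ 2) ^ (-(i : ℝ)) * w (‖x - a‖ ^ 2))
        ((contDiff_rpow_mul hw hs hws (-(i : ℝ))).comp hd)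
        (fun x => mul_nonneg (Real.rpow_nonneg (sq_nonneg _) _) (hw0 _)) fun x => by
          rw [hval]
          change wedgeTest (beta n ^ q) (ofFunction f₂) x - (k : ℂ) • ψ i x = _
          rw [wedgeTest_apply, ofFunction_apply, mul_smul_comm, mul_one]
          rfl)
    have e : wedgeTest (beta n ^ (n - m)) (wedgeTest (beta n ^ q) (ofFunction f₂) -
        (k : ℂ) • ψ i) = wedgeTest (beta n ^ p) (ofFunction f₂) - (k : ℂ) • ψ (p - 1) := by
      ext x : 1
      change beta n ^ (n - m) * (beta n ^ q * ofFunction f₂ x -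
        (k : ℂ) • (((w (‖x - a‖ ^ 2) : ℝ) : ℂ) • (beta n ^ i * form11 (levi a x)))) =
        beta n ^ p * ofFunction f₂ x -
        (k : ℂ) • (((w (‖x - a‖ ^ 2) : ℝ) : ℂ) • (beta n ^ (p - 1) * form11 (levi a x)))
      rw [mul_sub, mul_smul_comm, mul_smul_comm, ← mul_assoc, ← mul_assoc, ← pow_add, ← pow_add,
        show n - m + q = p by omega, show n - m + i = p - 1 by omega]
    change 0 ≤ T (wedgeTest _ _) at h
    rwa [e, map_sub, map_smul, smul_eq_mul] at h
  -- Adding `k` times `h1` to `h2` eliminates the mixed term `T (ψ (p - 1))`.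
  have h3 : 0 ≤ T (wedgeTest (beta n ^ p) (ofFunction f₂)) -
      (k : ℂ) * T (wedgeTest (beta n ^ p) (ofFunction f₁)) := by
    have := add_nonneg h2 (mul_nonneg (Complex.zero_le_real.2 hk0) h1)
    convert this using 1
    ring
  have h4 := hσ.eq_integral (f₂ - (k : ℂ) • f₁)
  have h5 : ∫ x, (f₂ - (k : ℂ) • f₁) x ∂σ = ((∫ x, (‖x - a‖ ^ 2 * w (‖x - a‖ ^ 2) -
      k * tailIntegral R w (‖x - a‖ ^ 2)) ∂σ : ℝ) : ℂ) := by
    rw [← integral_complex_ofReal]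
    refine integral_congr_ae (.of_forall fun x => ?_)
    change ((‖x - a‖ ^ 2 * w (‖x - a‖ ^ 2) : ℝ) : ℂ) -
      (k : ℂ) * ((tailIntegral R w (‖x - a‖ ^ 2) : ℝ) : ℂ) = _
    push_cast
    rfl
  have h6 : T.wedgeBeta p (ofFunction (f₂ - (k : ℂ) • f₁)) =
      T (wedgeTest (beta n ^ p) (ofFunction f₂)) -
      (k : ℂ) * T (wedgeTest (beta n ^ p) (ofFunction f₁)) := by
    change T (wedgeTest _ _) = _
    rw [map_sub, map_sub, map_sub, map_smul, map_smul, map_smul, smul_eq_mul]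
  rw [← h6, h4, h5] at h3
  exact Complex.zero_le_real.1 h3

/-- The radial inequality passes to the limit along `weight` with `s = r₁²`, `R = r₂²`. The closed
and open balls reflect the limits of the integrand at `t = s` and `t = R`. -/
theorem rpow_mul_measure_closedBall_le (hm : 1 ≤ m) (hmn : m < n) (hp : p ≤ n) (hmp : n < m + p)
    (hpos : T.IsMPositive m p) {μ σ : Measure (Cn n)}
    (hμ : (T.ddc.wedgeBeta (p - 1)).IsMeasure μ) (hσ : (T.wedgeBeta p).IsMeasure σ)
    {a : Cn n} {r₁ r₂ : ℝ} (h₁ : 0 < r₁) (h₁₂ : r₁ < r₂)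
    (hball : Metric.closedBall a r₂ ⊆ Ω) :
    (r₁ ^ 2) ^ (-((m + p - n : ℕ) * (n / m) : ℝ)) * σ.real (Metric.closedBall a r₁) ≤
      (r₂ ^ 2) ^ (-((m + p - n : ℕ) * (n / m) : ℝ)) * σ.real (Metric.ball a r₂) := by
  set k : ℝ := (m + p - n : ℕ) * (n / m) with hk
  have hk0 : 0 < k := by
    have : 0 < m + p - n := by omega
    have : 0 < n := by omega
    positivity
  have h₂ : 0 < r₂ := h₁.trans h₁₂
  have hs : 0 < r₁ ^ 2 := by positivity
  have hsR : r₁ ^ 2 < r₂ ^ 2 := pow_lt_pow_left₀ h₁₂ h₁.le two_ne_zero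
  have hfin : σ (Metric.closedBall a r₂) < ⊤ := hσ.finite _ (isCompact_closedBall a r₂) hball
  have hd : Continuous fun x : Cn n => ‖x - a‖ ^ 2 := (contDiff_distSq a).continuous
  have hlim := tendsto_integral_of_dominated_convergence (μ := σ)
    (F := fun j x => ‖x - a‖ ^ 2 * weight k (r₁ ^ 2) (r₂ ^ 2) j (‖x - a‖ ^ 2) -
      k * tailIntegral (r₂ ^ 2) (weight k (r₁ ^ 2) (r₂ ^ 2) j) (‖x - a‖ ^ 2))
    (f := fun x => (Set.Iio (r₂ ^ 2)).indicator (fun _ => (r₂ ^ 2) ^ (-k)) (‖x - a‖ ^ 2) -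
        (Set.Iic (r₁ ^ 2)).indicator (fun _ => (r₁ ^ 2) ^ (-k)) (‖x - a‖ ^ 2))
    ((Metric.closedBall a r₂).indicator fun _ => (r₁ ^ 2) ^ (-k)) (fun j => by
      have hw := contDiff_weight (k := k) (R := r₂ ^ 2) hs j
      exact ((hd.mul (hw.continuous.comp hd)).sub (continuous_const.mul
        ((contDiff_tailIntegral hw _).continuous.comp hd))).aestronglyMeasurable)
    ((integrable_indicator_iff Metric.isClosed_closedBall.measurableSet).2
      (integrableOn_const hfin.ne))
    (fun j => .of_forall fun x => by
      by_cases hx : x ∈ Metric.closedBall a r₂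
      · rw [Set.indicator_of_mem hx]
        exact abs_radial_le hk0 hs hsR.le j _
      · rw [Set.indicator_of_notMem hx]
        rw [mem_closedBall_iff_norm, not_le] at hx
        have hx' : r₂ ^ 2 ≤ ‖x - a‖ ^ 2 := pow_le_pow_left₀ h₂.le hx.le 2
        rw [weight_of_ge j hx', tailIntegral_eq_zero (fun u hu => weight_of_ge j hu) hx']
        simp)
    (.of_forall fun x => tendsto_radial hk0 hs hsR _)
  have hnn := ge_of_tendsto' hlim fun j =>
    integral_radial_nonneg hm hmn hp hmp hpos hμ hσ h₂.le rfl hball hs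
      (contDiff_weight hs j) (weight_nonneg hs j) (fun t ht => weight_of_le j ht)
      (fun t ht => weight_of_ge j ht)
  have e₁ : ∀ x : Cn n, (Set.Iic (r₁ ^ 2)).indicator (fun _ => (r₁ ^ 2) ^ (-k)) (‖x - a‖ ^ 2) =
      (Metric.closedBall a r₁).indicator (fun _ => (r₁ ^ 2) ^ (-k)) x := fun x => by
    simp only [Set.indicator, Set.mem_Iic, mem_closedBall_iff_norm,
      pow_le_pow_iff_left₀ (norm_nonneg (x - a)) h₁.le two_ne_zero]
  have e₂ : ∀ x : Cn n, (Set.Iio (r₂ ^ 2)).indicator (fun _ => (r₂ ^ 2) ^ (-k)) (‖x - a‖ ^ 2) =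
      (Metric.ball a r₂).indicator (fun _ => (r₂ ^ 2) ^ (-k)) x := fun x => by
    simp only [Set.indicator, Set.mem_Iio, mem_ball_iff_norm,
      pow_lt_pow_iff_left₀ (norm_nonneg (x - a)) h₂.le two_ne_zero]
  simp only [e₁, e₂] at hnn
  rw [integral_sub, integral_indicator_const _ Metric.isOpen_ball.measurableSet,
    integral_indicator_const _ Metric.isClosed_closedBall.measurableSet, smul_eq_mul,
    smul_eq_mul] at hnn
  · linarith
  · exact (integrable_indicator_iff Metric.isOpen_ball.measurableSet).2
      (integrableOn_const ((measure_mono Metric.ball_subset_closedBall).trans_lt hfin).ne)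
  · exact (integrable_indicator_iff Metric.isClosed_closedBall.measurableSet).2
      (integrableOn_const ((measure_mono
        (Metric.closedBall_subset_closedBall h₁₂.le)).trans_lt hfin).ne)

/-- The closed ball is connected, meets `Ω` at `a` and misses the frontier. -/
lemma closedBall_subset_of_mem_radii {a : Cn n} (ha : a ∈ Ω) {r : ℝ}
    (hr : r ∈ radii (Ω : Set (Cn n)) a) : Metric.closedBall a r ⊆ Ω := by
  refine (convex_closedBall a r).isPreconnected.subset_of_closure_inter_subset Ω.isOpen
    ⟨a, Metric.mem_closedBall_self hr.1.le, ha⟩ ?_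
  rintro x ⟨hx, hxr⟩
  by_contra hxΩ
  have hxf : x ∈ frontier (Ω : Set (Cn n)) := by
    rw [frontier, Ω.isOpen.interior_eq]
    exact ⟨hx, hxΩ⟩
  have h := hr.2.trans_le (Metric.infEDist_le_edist_of_mem (x := a) hxf)
  rw [edist_dist, ENNReal.ofReal_lt_ofReal_iff_of_nonneg hr.1.le, dist_comm] at h
  exact absurd hxr (not_le.2 h)

lemma exists_Ioo_subset_radii {a : Cn n} (ha : a ∈ Ω) :
    ∃ R > 0, Set.Ioo 0 R ⊆ radii (Ω : Set (Cn n)) a := by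
  have ha' : a ∉ closure (frontier (Ω : Set (Cn n))) := by
    rw [isClosed_frontier.closure_eq, frontier, Ω.isOpen.interior_eq]
    exact fun h => h.2 ha
  obtain ⟨R, hR, h⟩ := Metric.exists_real_pos_lt_infEDist_of_notMem_closure ha'
  exact ⟨R, hR, fun r hr => ⟨hr.1, (ENNReal.ofReal_le_ofReal hr.2.le).trans_lt h⟩⟩

lemma lelongFunction_nonneg (σ : Measure (Cn n)) (a : Cn n) {r : ℝ} (hr : 0 ≤ r) :
    0 ≤ lelongFunction m p σ a r :=
  mul_nonneg (one_div_nonneg.2 (Real.rpow_nonneg hr _)) measureReal_nonneg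

lemma lelongFunction_eq (hmp : n ≤ m + p) (σ : Measure (Cn n)) (a : Cn n) {r : ℝ} (hr : 0 ≤ r) :
    lelongFunction m p σ a r =
      (r ^ 2) ^ (-((m + p - n : ℕ) * (n / m) : ℝ)) * σ.real (Metric.ball a r) := by
  rw [lelongFunction, one_div, ← Real.rpow_neg hr, ← Real.rpow_natCast r 2, ← Real.rpow_mul hr,
    Nat.cast_sub hmp]
  congr 2
  push_cast
  ring

theorem monotoneOn_lelongFunction (hm : 1 ≤ m) (hmn : m < n) (hp : p ≤ n) (hmp : n ≤ m + p)
    (hpos : T.IsMPositive m p) {μ σ : Measure (Cn n)}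
    (hμ : (T.ddc.wedgeBeta (p - 1)).IsMeasure μ) (hσ : (T.wedgeBeta p).IsMeasure σ)
    {a : Cn n} (ha : a ∈ Ω) :
    MonotoneOn (lelongFunction m p σ a) (radii (Ω : Set (Cn n)) a) := by
  intro r₁ h₁ r₂ h₂ h₁₂
  have hball := closedBall_subset_of_mem_radii ha h₂
  have hfin : σ (Metric.closedBall a r₂) < ⊤ := hσ.finite _ (isCompact_closedBall a r₂) hball
  rw [lelongFunction_eq hmp _ _ h₁.1.le, lelongFunction_eq hmp _ _ h₂.1.le]
  rcases h₁₂.eq_or_lt with rfl | hlt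
  · exact le_rfl
  -- When `m + p = n` the exponent is `0` and only monotonicity of the measure is needed.
  rcases hmp.eq_or_lt with heq | hlt'
  · rw [← heq, Nat.sub_self, Nat.cast_zero, zero_mul, neg_zero, Real.rpow_zero, Real.rpow_zero,
      one_mul, one_mul]
    exact measureReal_mono (Metric.ball_subset_ball h₁₂)
      ((measure_mono Metric.ball_subset_closedBall).trans_lt hfin).ne
  · refine le_trans ?_ (rpow_mul_measure_closedBall_le hm hmn hp hlt' hpos hμ hσ h₁.1 hlt hball)
    exact mul_le_mul_of_nonneg_left (measureReal_mono Metric.ball_subset_closedBall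
      ((measure_mono (Metric.closedBall_subset_closedBall h₁₂)).trans_lt hfin).ne)
      (Real.rpow_nonneg (sq_nonneg _) _)

end Inequality

end Lelong

end

theorem mainTheorem2 (n m p : ℕ) (hm : 1 ≤ m) (hmn : m < n) (hp : p ≤ n) (hmp : n ≤ m + p)
    (Ω : TopologicalSpace.Opens (Lelong.Cn n)) (T : Lelong.Current Ω)
    (hT : T.HasBidimension p) (hpos : T.IsMPositive m p)
    (hddc : ∃ μ : Measure (Lelong.Cn n), (T.ddc.wedgeBeta (p - 1)).IsMeasure μ) :
    (∃ σ : Measure (Lelong.Cn n), (T.wedgeBeta p).IsMeasure σ) ∧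
    ∀ σ : Measure (Lelong.Cn n), (T.wedgeBeta p).IsMeasure σ → ∀ a ∈ Ω,
      (∀ r ∈ Lelong.radii (Ω : Set (Lelong.Cn n)) a, σ (Metric.ball a r) < ⊤ ∧
        0 ≤ Lelong.lelongFunction m p σ a r) ∧
      MonotoneOn (Lelong.lelongFunction m p σ a) (Lelong.radii (Ω : Set (Lelong.Cn n)) a) ∧
      ∃ ν : ℝ, Tendsto (Lelong.lelongFunction m p σ a) (𝓝[>] 0) (𝓝 ν) := by
  obtain ⟨μ, hμ⟩ := hddc
  refine ⟨Lelong.exists_isMeasure_wedgeBeta hmn.le hp hmp hpos, fun σ hσ a ha => ?_⟩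
  have hmono := Lelong.monotoneOn_lelongFunction hm hmn hp hmp hpos hμ hσ ha
  refine ⟨fun r hr => ⟨?_, Lelong.lelongFunction_nonneg σ a hr.1.le⟩, hmono, ?_⟩
  · exact (measure_mono Metric.ball_subset_closedBall).trans_lt (hσ.finite _
      (isCompact_closedBall a r) (Lelong.closedBall_subset_of_mem_radii ha hr))
  -- A monotone function on `(0, R)` bounded below by `0` has a finite right limit at `0`.
  · obtain ⟨R, hR, hsub⟩ := Lelong.exists_Ioo_subset_radii ha
    exact ⟨_, (hmono.mono hsub).tendsto_nhdsWithin_Ioo_right ⟨R / 2, by simp [hR]⟩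
      ⟨0, by rintro _ ⟨r, hr, rfl⟩; exact Lelong.lelongFunction_nonneg σ a hr.1.le⟩⟩
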